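/- Let $H\in(1/2,1)$. Let $\beta$ denote the Beta function and put \[ d(H)=\frac1{H+1}\sqrt{\frac{2(2H-1)}{H}},\qquad c_{1,H}=4\,d(H),\qquad c(h)=\sqrt{\frac{h(2h-1)}{\beta(2-2h,\,h-\frac12)}}\quad(\tfrac12<h<1), \] \[ K^{h}(t,s)=c(h)\,s^{\frac12-h}\int_s^t(u-s)^{h-\frac32}u^{h-\frac12}\,du\qquad(0<s<t), \] \[ L_t(y_1,y_2)=d(H)\,\mathbf 1_{[0,t]^2}(y_1,y_2)\int_{y_1\vee y_2}^t\partial_1K^{\frac{H+1}2}(u,y_1)\,\partial_1K^{\frac{H+1}2}(u,y_2)\,du , \] \[ \rho_H(k)=\tfrac12\big(|k+1|^{2H}+|k-1|^{2H}-2|k|^{2H}\big),\qquad k\in\mathbb Z . \] Let $B=(B^1,\dots,B^n)$ be an $n$-dimensional standard Brownian motion, let $I_2^i$ denote the double Wiener integral with respect to $B^i$, and let $Z^{H,i}_t=I_2^i(L_t)$, $t\ge 0$; thus $Z^{H,1},\dots,Z^{H,n}$ are independent Rosenblatt processes with Hurst parameter $H$. For $d\ge1$ let $\mathcal X_{n,d}$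 be the $n\times d$ matrix with entries $X_{ik}=Z^{H,i}_k-Z^{H,i}_{k-1}$, let $\mathcal W_{n,d}=\frac1d\mathcal X_{n,d}\mathcal X_{n,d}^T-\mathcal I_n=(W_{ij})_{1\le i,j\le n}$ (where $\mathcal I_n$ is the identity matrix), and let $\widetilde W_{ij}=c_{1,H}^{-1}d^{1-H}W_{ij}$. Then, for $1\le i,j\le n$ with $i\ne j$, $\widetilde W_{ij}$ is square integrable for every $d\geq 1$, $\widetilde W_{ij}\to0$ in $L^2(\Omega)$ as $d\to\infty$, and for every $d\ge1$ \[ \mathbb E\big(\widetilde W_{ij}^2\big)=c_{1,H}^{-2}\,d^{-2H}\sum_{k,l=0}^{d-1}\rho_H(k-l)^2 . \] Moreover, there is a constant $C>0$ depending only on $H$ such that \[ \mathbb E\big(\widetilde W_{ij}^2\big)\le C\begin{cases} d^{1-2H} & \text{if } H\in(\frac12,\frac34)\text{ and } d\ge1,\\ \log(d)\,d^{-\frac12} & \text{if } H=\frac34\text{ and } d\ge2,\\ d^{2H-2} & \text{if } H\in(\frac34,1)\text{ and } d\ge1.\end{cases} \] -/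

import Mathlib

open MeasureTheory ProbabilityTheory Filter
open scoped ENNReal NNReal Topology Matrix

namespace RosenblattWishart

noncomputable section

/-- `B` is an `n`-dimensional standard Brownian motion `(B¹, …, Bⁿ)` under `P`: the components are
independent one-dimensional standard Brownian motions. -/
structure IsBrownianVector {Ω : Type*} [MeasurableSpace Ω] (P : Measure Ω) {n : ℕ}
    (B : Fin n → ℝ≥0 → Ω → ℝ) : Prop where
  isBrownian : ∀ i, IsBrownianReal (B i) P
  indep : iIndepFun (fun i ω t ↦ B i t ω) P

/-! ### The double Wiener integral with respect to a Brownian motion -/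

/-- A rectangle `(a₁, b₁] × (a₂, b₂]` in `[0, ∞)²` whose sides are disjoint intervals, so that it
does not meet the diagonal. -/
structure OffDiagRect where
  (a₁ b₁ a₂ b₂ : ℝ≥0)
  le₁ : a₁ ≤ b₁
  le₂ : a₂ ≤ b₂
  disj : b₁ ≤ a₂ ∨ b₂ ≤ a₁

/-- The underlying set of an off-diagonal rectangle. -/
def OffDiagRect.toSet (R : OffDiagRect) : Set (ℝ × ℝ) :=
  Set.Ioc (R.a₁ : ℝ) R.b₁ ×ˢ Set.Ioc (R.a₂ : ℝ) R.b₂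

/-- A formal finite linear combination of off-diagonal rectangles, seen as a step function. -/
def stepFun : (OffDiagRect →₀ ℝ) →ₗ[ℝ] (ℝ × ℝ → ℝ) :=
  Finsupp.linearCombination ℝ fun R : OffDiagRect ↦ R.toSet.indicator 1

/-- The double Wiener integral of a step function: the linear extension of
`1_{(a₁, b₁] × (a₂, b₂]} ↦ (B_{b₁} - B_{a₁}) (B_{b₂} - B_{a₂})`. -/
def stepIntegral {Ω : Type*} (B : ℝ≥0 → Ω → ℝ) : (OffDiagRect →₀ ℝ) →ₗ[ℝ] (Ω → ℝ) :=
  Finsupp.linearCombination ℝ fun R : OffDiagRect ↦ (B R.b₁ - B R.a₁) * (B R.b₂ - B R.a₂)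

/-- Lebesgue measure on the quadrant `[0, ∞)²`. -/
def quadrant : Measure (ℝ × ℝ) := volume.restrict (Set.Ici 0 ×ˢ Set.Ici 0)

/-- `F` is (a version of) the double Wiener integral `I₂(f)` of `f ∈ L²([0, ∞)²)` with respect to
`B`: the limit in `L²(P)` of the integrals of off-diagonal step functions converging to `f` in
`L²([0, ∞)²)`. -/
def IsDoubleWienerIntegral {Ω : Type*} [MeasurableSpace Ω] (P : Measure Ω) (B : ℝ≥0 → Ω → ℝ)
    (f : ℝ × ℝ → ℝ) (F : Ω → ℝ) : Prop :=
  MemLp f 2 quadrant ∧ MemLp F 2 P ∧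
    ∃ φ : ℕ → OffDiagRect →₀ ℝ,
      Tendsto (fun m ↦ eLpNorm (stepFun (φ m) - f) 2 quadrant) atTop (𝓝 0) ∧
      Tendsto (fun m ↦ eLpNorm (stepIntegral B (φ m) - F) 2 P) atTop (𝓝 0)

open Classical in
/-- The double Wiener integral `I₂(f)` with respect to `B`, as a random variable defined up to
almost sure equality (and `0` if there is no such integral). -/
def doubleWienerIntegral {Ω : Type*} [MeasurableSpace Ω] (P : Measure Ω) (B : ℝ≥0 → Ω → ℝ)
    (f : ℝ × ℝ → ℝ) : Ω → ℝ :=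
  if h : ∃ F, IsDoubleWienerIntegral P B f F then h.choose else 0

/-! ### The Rosenblatt process -/

/-- `c(H) = √(H (2H - 1) / β(2 - 2H, H - 1/2))`. -/
def volterraConst (H : ℝ) : ℝ :=
  √(H * (2 * H - 1) / ProbabilityTheory.beta (2 - 2 * H) (H - 1 / 2))

/-- `K^H(t, s) = c(H) s^{1/2 - H} ∫_s^t (u - s)^{H - 3/2} u^{H - 1/2} du`, for `0 < s < t`. -/
def volterraKernel (H t s : ℝ) : ℝ :=
  volterraConst H * s ^ (1 / 2 - H) *
    ∫ u in s..t, (u - s) ^ (H - 3 / 2) * u ^ (H - 1 / 2)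

/-- `d(H) = (H + 1)⁻¹ √(2 (2H - 1) / H)`. -/
def rosenblattConst (H : ℝ) : ℝ :=
  1 / (H + 1) * √(2 * (2 * H - 1) / H)

/-- The kernel `L_t(y₁, y₂) = d(H) 1_{[0,t]²}(y₁, y₂)
∫_{y₁ ∨ y₂}^t ∂₁K^{(H+1)/2}(u, y₁) ∂₁K^{(H+1)/2}(u, y₂) du`. -/
def rosenblattKernel (H t : ℝ) : ℝ × ℝ → ℝ :=
  (Set.Icc 0 t ×ˢ Set.Icc 0 t).indicator fun y ↦
    rosenblattConst H * ∫ u in (max y.1 y.2)..t,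
      deriv (fun r ↦ volterraKernel ((H + 1) / 2) r y.1) u *
        deriv (fun r ↦ volterraKernel ((H + 1) / 2) r y.2) u

/-- The Rosenblatt process `Z^H_t = I₂(L_t)`, `t ≥ 0`, driven by the Brownian motion `B`. -/
def rosenblatt {Ω : Type*} [MeasurableSpace Ω] (P : Measure Ω) (B : ℝ≥0 → Ω → ℝ) (H t : ℝ) :
    Ω → ℝ :=
  doubleWienerIntegral P B (rosenblattKernel H t)

/-! ### The Wishart matrix -/

/-- The `n × d` random matrix `X_{ij} = Z^{H,i}_j - Z^{H,i}_{j-1}`, `1 ≤ i ≤ n`, `1 ≤ j ≤ d`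
(columns are numbered from `0` here). -/
def dataMatrix {Ω : Type*} [MeasurableSpace Ω] (P : Measure Ω) {n : ℕ}
    (B : Fin n → ℝ≥0 → Ω → ℝ) (H : ℝ) (d : ℕ) (ω : Ω) : Matrix (Fin n) (Fin d) ℝ :=
  Matrix.of fun i j ↦
    rosenblatt P (B i) H ((j : ℕ) + 1 : ℝ) ω - rosenblatt P (B i) H ((j : ℕ) : ℝ) ω

/-- The centered Wishart matrix `d⁻¹ X Xᵀ - I`. -/
def wishart {n d : ℕ} (X : Matrix (Fin n) (Fin d) ℝ) : Matrix (Fin n) (Fin n) ℝ :=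
  (1 / (d : ℝ)) • (X * Xᵀ) - 1

/-- `c_{1,H} = 4 d(H)`. -/
def c₁ (H : ℝ) : ℝ := 4 * rosenblattConst H

/-- The entry `c_{1,H}⁻¹ d^{1-H} W_{ij}` of the renormalized Wishart matrix. -/
def renormWishart {Ω : Type*} [MeasurableSpace Ω] (P : Measure Ω) {n : ℕ}
    (B : Fin n → ℝ≥0 → Ω → ℝ) (H : ℝ) (d : ℕ) (i j : Fin n) (ω : Ω) : ℝ :=
  (c₁ H)⁻¹ * (d : ℝ) ^ (1 - H) * wishart (dataMatrix P B H d ω) i j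

/-- `ρ_H(k) = (|k + 1|^{2H} + |k - 1|^{2H} - 2 |k|^{2H}) / 2`. -/
def rho (H : ℝ) (k : ℤ) : ℝ :=
  1 / 2 * (|(k : ℝ) + 1| ^ (2 * H) + |(k : ℝ) - 1| ^ (2 * H) - 2 * |(k : ℝ)| ^ (2 * H))

end

end RosenblattWishart

/-!
For `i ≠ j`, the entry `W_{ij}` is `d⁻¹ ∑ₖ X_{ik} X_{jk}`, where `X_{ik}` and `X_{jk}` are
increments of two independent Rosenblatt processes. Expanding the square and factoring the expectations
over the two processes gives `E[W_{ij}²] = d⁻² ∑ₖ ∑ₗ (E[X_{ik} X_{il}])²`, so the exact second moment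
amounts to the Rosenblatt process having the covariance of fractional Brownian motion
(`integral_rosenblatt_mul`), that is `E[X_{ik} X_{il}] = ρ_H(k - l)`.

The covariance comes from two facts.

* The double Wiener integral satisfies `E[I₂(f) I₂(g)] = ⟨f, g⟩ + ⟨f, gᵀ⟩`
  (`IsDoubleWienerIntegral.integral_mul`). On off-diagonal rectangles this is Isserlis' formula for
  four increments of Brownian motion (`integral_mul_mul_mul_of_gaussian`); the pairing inside a
  rectangle vanishes because its sides are disjoint. The general case follows by bilinearity and
  `L²` limits. The same isometry and the density of the step functions (`denseRange_stepFunLp`) show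
  that `I₂(f)` exists for every square integrable `f`.
* For `h = (H + 1) / 2`, a Beta integral gives
  `∫ ∂₁K^h(u, y) ∂₁K^h(v, y) dy = h (2h - 1) |u - v|^{2h - 2}` (`lintegral_volterraDeriv_mul`). By
  Tonelli's theorem `⟨L_s, L_t⟩` is then a multiple of `∫₀ˢ ∫₀ᵗ |u - v|^{2H - 2} dv du`, which is
  explicit (`integral_rosenblattKernel_mul`). Working with `[0, ∞]`-valued integrals gives the
  square integrability of `L_t` at the same time.

The factoring of expectations uses that `I₂(f)` is almost surely a measurable functional of the
Brownian path (`IsDoubleWienerIntegral.exists_measurable_path`).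

The rates follow from `ρ_H(k) = O(|k|^{2H - 2})`, a mean value estimate, and from the behaviour of
`∑_{m ≤ d} m^{4H - 4}`, which is bounded, logarithmic, or of order `d^{4H - 3}` according to whether
`H` is below, at, or above `3/4` (`exists_sum_sum_rho_sq_le`). Each rate tends to `0`.
-/

namespace RosenblattWishart

section WienerIntegral

variable {Ω : Type*} [MeasurableSpace Ω] {P : Measure Ω} {B : ℝ≥0 → Ω → ℝ}

/-! ### Gaussian moments of order four -/

/-- The fourth derivative at `0` of the moment generating function `exp (v t² / 2)`. -/
theorem integral_pow_four_gaussianReal (v : ℝ≥0) :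
    ∫ x, x ^ 4 ∂gaussianReal 0 v = 3 * (v : ℝ) ^ 2 := by
  have h := iteratedDeriv_mgf_zero (X := id) (μ := gaussianReal 0 v)
    (by rw [integrableExpSet_id_gaussianReal]; simp) 4
  simp only [Pi.pow_apply, id] at h
  rw [← h, mgf_id_gaussianReal]
  have hp (p : ℝ → ℝ) (p' : ℝ → ℝ) (hp : ∀ t, HasDerivAt p (p' t) t) :
      deriv (fun t ↦ p t * Real.exp (0 * t + v * t ^ 2 / 2)) =
        fun t ↦ (p' t + p t * (v * t)) * Real.exp (0 * t + v * t ^ 2 / 2) := by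
    funext t
    have h1 : HasDerivAt (fun t : ℝ ↦ 0 * t + (v : ℝ) * t ^ 2 / 2) (v * t) t := by
      have := (((hasDerivAt_id t).const_mul (0 : ℝ)).add
        (((hasDerivAt_pow 2 t).const_mul (v : ℝ)).div_const 2))
      convert! this using 1
      simp; ring
    rw [((hp t).fun_mul h1.exp).deriv]
    ring
  have e0 : (fun t : ℝ ↦ Real.exp (0 * t + v * t ^ 2 / 2)) =
      fun t ↦ 1 * Real.exp (0 * t + v * t ^ 2 / 2) := by simp
  rw [e0, iteratedDeriv_succ', iteratedDeriv_succ', iteratedDeriv_succ', iteratedDeriv_one,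
    hp (fun _ ↦ 1) (fun _ ↦ 0) (fun t ↦ hasDerivAt_const _ _),
    hp (fun t ↦ 0 + 1 * (v * t)) (fun _ ↦ v) (fun t ↦ by
      simpa using (hasDerivAt_id t).const_mul (v : ℝ)),
    hp (fun t ↦ v + (0 + 1 * (v * t)) * (v * t)) (fun t ↦ 2 * v ^ 2 * t) (fun t ↦ by
      have := ((hasDerivAt_pow 2 t).const_mul ((v : ℝ) ^ 2)).const_add (v : ℝ)
      convert! this using 1
      · ext; ring
      · simp; ring),
    hp (fun t ↦ 2 * v ^ 2 * t + (v + (0 + 1 * (v * t)) * (v * t)) * (v * t))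
      (fun t ↦ 3 * v ^ 2 + 3 * v ^ 3 * t ^ 2) (fun t ↦ by
      have := ((hasDerivAt_id t).const_mul (3 * (v : ℝ) ^ 2)).add
        ((hasDerivAt_pow 3 t).const_mul ((v : ℝ) ^ 3))
      convert! this using 1
      · ext t; simp; ring
      · simp; ring)]
  simp

/-- A centred real Gaussian variable satisfies `E[X⁴] = 3 E[X²]²`. -/
theorem integral_pow_four_of_hasGaussianLaw {X : Ω → ℝ} (hX : HasGaussianLaw X P)
    (h0 : ∫ ω, X ω ∂P = 0) : ∫ ω, X ω ^ 4 ∂P = 3 * (∫ ω, X ω ^ 2 ∂P) ^ 2 := by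
  have hm := hX.map_eq_gaussianReal
  rw [h0] at hm
  have h4 : ∫ ω, X ω ^ 4 ∂P = ∫ x, x ^ 4 ∂(P.map X) :=
    (integral_map (f := fun x : ℝ ↦ x ^ 4) hX.aemeasurable (by fun_prop)).symm
  rw [h4, hm, integral_pow_four_gaussianReal, Real.coe_toNNReal _ (variance_nonneg _ _),
    variance_of_integral_eq_zero hX.aemeasurable h0]

/-- **Isserlis' formula** of order four. It follows from `E[X⁴] = 3 E[X²]²` by polarization, over
the eight linear combinations `X₁ ± X₂ ± X₃ ± X₄`. -/
theorem integral_mul_mul_mul_of_gaussian {X : Fin 4 → Ω → ℝ}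
    (hX : ∀ c : Fin 4 → ℝ, HasGaussianLaw (fun ω ↦ ∑ i, c i * X i ω) P)
    (h0 : ∀ i, ∫ ω, X i ω ∂P = 0) :
    ∫ ω, X 0 ω * X 1 ω * (X 2 ω * X 3 ω) ∂P =
      (∫ ω, X 0 ω * X 1 ω ∂P) * (∫ ω, X 2 ω * X 3 ω ∂P)
      + (∫ ω, X 0 ω * X 2 ω ∂P) * (∫ ω, X 1 ω * X 3 ω ∂P)
      + (∫ ω, X 0 ω * X 3 ω ∂P) * (∫ ω, X 1 ω * X 2 ω ∂P) := by
  have hg (i : Fin 4) : HasGaussianLaw (X i) P := by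
    have := hX (Pi.single i 1)
    simpa [Pi.single_apply] using this
  have hi2 (i j : Fin 4) : Integrable (fun ω ↦ X i ω * X j ω) P :=
    (hg i).memLp_two.integrable_mul (hg j).memLp_two
  have hL4 (c : Fin 4 → ℝ) : Integrable (fun ω ↦ (∑ i, c i * X i ω) ^ 4) P := by
    have := ((hX c).memLp (p := 4) (by simp)).integrable_norm_pow (by simp)
    refine this.congr (ae_of_all _ fun ω ↦ ?_)
    simp only [Real.norm_eq_abs]
    exact Even.pow_abs (by decide) _
  have hmean (c : Fin 4 → ℝ) : ∫ ω, ∑ i, c i * X i ω ∂P = 0 := by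
    rw [integral_finsetSum _ fun i _ ↦ (hg i).integrable.const_mul _]
    simp [integral_const_mul, h0]
  have hsq (c : Fin 4 → ℝ) : ∫ ω, (∑ i, c i * X i ω) ^ 2 ∂P =
      ∑ i, ∑ j, c i * c j * ∫ ω, X i ω * X j ω ∂P := by
    have : ∀ ω, (∑ i, c i * X i ω) ^ 2 = ∑ i, ∑ j, c i * c j * (X i ω * X j ω) := fun ω ↦ by
      rw [sq, Finset.sum_mul_sum]
      exact Finset.sum_congr rfl fun i _ ↦ Finset.sum_congr rfl fun j _ ↦ by ring
    simp_rw [this]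
    rw [integral_finsetSum _ fun i _ ↦ integrable_finsetSum _ fun j _ ↦ (hi2 i j).const_mul _]
    refine Finset.sum_congr rfl fun i _ ↦ ?_
    rw [integral_finsetSum _ fun j _ ↦ (hi2 i j).const_mul _]
    simp [integral_const_mul]
  have h4 (c : Fin 4 → ℝ) : ∫ ω, (∑ i, c i * X i ω) ^ 4 ∂P =
      3 * (∑ i, ∑ j, c i * c j * ∫ ω, X i ω * X j ω ∂P) ^ 2 := by
    rw [integral_pow_four_of_hasGaussianLaw (hX c) (hmean c), hsq]
  let e : Bool → ℝ := fun b ↦ cond b 1 (-1)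
  have hpol : ∀ ω, X 0 ω * X 1 ω * (X 2 ω * X 3 ω) =
      ∑ b : Bool × Bool × Bool, e b.1 * e b.2.1 * e b.2.2 / 192 *
        (∑ i, (![1, e b.1, e b.2.1, e b.2.2] : Fin 4 → ℝ) i * X i ω) ^ 4 := fun ω ↦ by
    simp [Fintype.sum_prod_type, e, Fin.sum_univ_four]
    ring
  have hcomm (i j : Fin 4) : ∫ ω, X i ω * X j ω ∂P = ∫ ω, X j ω * X i ω ∂P := by
    simp_rw [mul_comm]
  simp_rw [hpol]
  rw [integral_finsetSum _ fun b _ ↦ (hL4 _).const_mul _]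
  simp_rw [integral_const_mul, h4]
  rw [show (∫ ω, X 0 ω * X 1 ω ∂P) = ∫ ω, X 1 ω * X 0 ω ∂P from hcomm _ _]
  simp [Fintype.sum_prod_type, e, Fin.sum_univ_four]
  rw [hcomm 0 1, hcomm 0 2, hcomm 0 3, hcomm 1 2, hcomm 1 3, hcomm 2 3]
  ring

/-! ### Increments of Brownian motion and the isometry on step functions -/

theorem hasGaussianLaw_sum_increments (hB : IsPreBrownianReal B P) {ι : Type*} [Fintype ι]
    (a b : ι → ℝ≥0) (c : ι → ℝ) :
    HasGaussianLaw (fun ω ↦ ∑ i, c i * (B (b i) - B (a i)) ω) P := by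
  classical
  let I : Finset ℝ≥0 := Finset.univ.image a ∪ Finset.univ.image b
  have ha (i) : a i ∈ I := by simp [I]
  have hb (i) : b i ∈ I := by simp [I]
  let L : (I → ℝ) →L[ℝ] ℝ := ∑ i, c i •
    (ContinuousLinearMap.proj (R := ℝ) (φ := fun _ : I ↦ ℝ) ⟨b i, hb i⟩ -
      ContinuousLinearMap.proj (R := ℝ) (φ := fun _ : I ↦ ℝ) ⟨a i, ha i⟩)
  have := (hB.isGaussianProcess.hasGaussianLaw I).map_fun L
  simpa [L] using this

theorem memLp_increment (hB : IsPreBrownianReal B P) (a b : ℝ≥0) {p : ℝ≥0∞} (hp : p ≠ ∞) :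
    MemLp (B b - B a) p P := by
  have := hasGaussianLaw_sum_increments hB (fun _ : Unit ↦ a) (fun _ ↦ b) (fun _ ↦ 1)
  have h2 := this.memLp hp
  simpa [← Pi.sub_def] using h2

theorem integral_increment (hB : IsPreBrownianReal B P) (a b : ℝ≥0) :
    ∫ ω, (B b - B a) ω ∂P = 0 := by
  simp only [Pi.sub_apply]
  rw [integral_sub (hB.integrable_eval _) (hB.integrable_eval _), hB.integral_eval,
    hB.integral_eval, sub_zero]

theorem integral_eval_mul_eval (hB : IsPreBrownianReal B P) (s t : ℝ≥0) :
    ∫ ω, B s ω * B t ω ∂P = min (s : ℝ) t := by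
  have : IsProbabilityMeasure P := hB.isGaussianProcess.isProbabilityMeasure
  have h := hB.covariance_eval s t
  rw [covariance_eq_sub (hB.isGaussianProcess.hasGaussianLaw_eval s).memLp_two
    (hB.isGaussianProcess.hasGaussianLaw_eval t).memLp_two, hB.integral_eval, hB.integral_eval] at h
  simpa using h

/-- The length of the intersection of two intervals is the covariance of the increments. -/
theorem integral_increment_mul_increment (hB : IsPreBrownianReal B P) {a b c d : ℝ≥0}
    (hab : a ≤ b) (hcd : c ≤ d) :
    ∫ ω, (B b - B a) ω * (B d - B c) ω ∂P =
      volume.real (Set.Ioc (a : ℝ) b ∩ Set.Ioc (c : ℝ) d) := by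
  have hi (s t : ℝ≥0) : Integrable (fun ω ↦ B s ω * B t ω) P :=
    (hB.isGaussianProcess.hasGaussianLaw_eval s).memLp_two.integrable_mul
      (hB.isGaussianProcess.hasGaussianLaw_eval t).memLp_two
  have : ∀ ω, (B b - B a) ω * (B d - B c) ω =
      (B b ω * B d ω - B b ω * B c ω) - (B a ω * B d ω - B a ω * B c ω) := fun ω ↦ by
    simp; ring
  simp_rw [this]
  rw [integral_sub (f := fun ω ↦ B b ω * B d ω - B b ω * B c ω)
      (g := fun ω ↦ B a ω * B d ω - B a ω * B c ω)
      ((hi _ _).sub (hi _ _)) ((hi _ _).sub (hi _ _)), integral_sub (hi _ _) (hi _ _),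
    integral_sub (hi _ _) (hi _ _)]
  simp_rw [integral_eval_mul_eval hB]
  rw [Set.Ioc_inter_Ioc, measureReal_def, Real.volume_Ioc, ENNReal.toReal_ofReal']
  have hab' : (a : ℝ) ≤ b := hab
  have hcd' : (c : ℝ) ≤ d := hcd
  simp only [max_def, min_def]
  split_ifs <;> linarith

theorem quadrant_eq_prod : quadrant =
    (volume.restrict (Set.Ici (0 : ℝ))).prod (volume.restrict (Set.Ici (0 : ℝ))) := by
  rw [quadrant, Measure.prod_restrict]; rfl

theorem measurePreserving_swap_quadrant : MeasurePreserving Prod.swap quadrant quadrant := by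
  rw [quadrant_eq_prod]
  exact Measure.measurePreserving_swap

theorem quadrant_Ioc_inter_prod (a b c d : ℝ≥0) (s t : Set ℝ) :
    quadrant.real ((Set.Ioc (a : ℝ) b ∩ s) ×ˢ (Set.Ioc (c : ℝ) d ∩ t)) =
      volume.real (Set.Ioc (a : ℝ) b ∩ s) * volume.real (Set.Ioc (c : ℝ) d ∩ t) := by
  have h (a b : ℝ≥0) (s : Set ℝ) : (volume.restrict (Set.Ici (0 : ℝ))) (Set.Ioc (a : ℝ) b ∩ s) =
      volume (Set.Ioc (a : ℝ) b ∩ s) :=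
    Measure.restrict_eq_self _ fun x hx ↦ a.2.trans hx.1.1.le
  rw [quadrant_eq_prod, measureReal_prod_prod]
  simp only [measureReal_def, h]

theorem OffDiagRect.measurableSet_toSet (R : OffDiagRect) : MeasurableSet R.toSet :=
  measurableSet_Ioc.prod measurableSet_Ioc

theorem OffDiagRect.quadrant_toSet_lt_top (R : OffDiagRect) : quadrant R.toSet < ∞ := by
  refine (Measure.restrict_apply_le _ _).trans_lt ?_
  rw [OffDiagRect.toSet, Measure.volume_eq_prod, Measure.prod_prod, Real.volume_Ioc,
    Real.volume_Ioc]
  exact ENNReal.mul_lt_top ENNReal.ofReal_lt_top ENNReal.ofReal_lt_top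

theorem stepFun_single (R : OffDiagRect) (c : ℝ) :
    stepFun (Finsupp.single R c) = c • R.toSet.indicator 1 := by
  simp [stepFun]

theorem stepIntegral_single {Ω : Type*} {B : ℝ≥0 → Ω → ℝ} (R : OffDiagRect) (c : ℝ) :
    stepIntegral B (Finsupp.single R c) = c • ((B R.b₁ - B R.a₁) * (B R.b₂ - B R.a₂)) := by
  simp [stepIntegral]

theorem memLp_stepFun (φ : OffDiagRect →₀ ℝ) {p : ℝ≥0∞} : MemLp (stepFun φ) p quadrant := by
  induction φ using Finsupp.induction_linear with
  | zero => simp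
  | add f g hf hg => rw [map_add]; exact hf.add hg
  | single R c =>
    rw [stepFun_single]
    exact (memLp_indicator_const p R.measurableSet_toSet (1 : ℝ)
      (Or.inr R.quadrant_toSet_lt_top.ne)).const_smul c

theorem memLp_stepIntegral (hB : IsPreBrownianReal B P) (φ : OffDiagRect →₀ ℝ) :
    MemLp (stepIntegral B φ) 2 P := by
  induction φ using Finsupp.induction_linear with
  | zero => simp
  | add f g hf hg => rw [map_add]; exact hf.add hg
  | single R c =>
    rw [stepIntegral_single]
    have : ENNReal.HolderTriple 4 4 2 := ⟨by
      rw [← two_mul, ← ENNReal.toReal_eq_toReal_iff' (by finiteness) (by finiteness)]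
      norm_num⟩
    exact ((memLp_increment hB R.a₂ R.b₂ (p := 4) (by simp)).mul
      (memLp_increment hB R.a₁ R.b₁ (p := 4) (by simp))).const_smul c

/-- The isometry on two off-diagonal rectangles, from Isserlis' formula. -/
theorem integral_stepIntegral_rect (hB : IsPreBrownianReal B P) (R S : OffDiagRect) :
    ∫ ω, ((B R.b₁ - B R.a₁) * (B R.b₂ - B R.a₂)) ω * ((B S.b₁ - B S.a₁) * (B S.b₂ - B S.a₂)) ω ∂P =
      quadrant.real (R.toSet ∩ S.toSet) + quadrant.real (R.toSet ∩ Prod.swap ⁻¹' S.toSet) := by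
  have h := integral_mul_mul_mul_of_gaussian
    (X := fun i ↦ B ((![R.b₁, R.b₂, S.b₁, S.b₂] : Fin 4 → ℝ≥0) i) -
      B ((![R.a₁, R.a₂, S.a₁, S.a₂] : Fin 4 → ℝ≥0) i))
    (fun c ↦ hasGaussianLaw_sum_increments hB _ _ c) (fun i ↦ integral_increment hB _ _)
  simp only [Matrix.cons_val] at h
  simp only [Pi.mul_apply]
  rw [h, integral_increment_mul_increment hB R.le₁ R.le₂,
    integral_increment_mul_increment hB S.le₁ S.le₂,
    integral_increment_mul_increment hB R.le₁ S.le₁,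
    integral_increment_mul_increment hB R.le₂ S.le₂,
    integral_increment_mul_increment hB R.le₁ S.le₂,
    integral_increment_mul_increment hB R.le₂ S.le₁]
  -- the two sides of an off-diagonal rectangle are disjoint, which kills the first pairing
  have hdisj : Set.Ioc (R.a₁ : ℝ) R.b₁ ∩ Set.Ioc (R.a₂ : ℝ) R.b₂ = ∅ := by
    ext x
    simp only [Set.mem_inter_iff, Set.mem_Ioc, Set.mem_empty_iff_false, iff_false]
    rintro ⟨⟨h1, h2⟩, h3, h4⟩
    rcases R.disj with h | h
    · have : (R.b₁ : ℝ) ≤ R.a₂ := h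
      linarith
    · have : (R.b₂ : ℝ) ≤ R.a₁ := h
      linarith
  have e1 : R.toSet ∩ S.toSet = (Set.Ioc (R.a₁ : ℝ) R.b₁ ∩ Set.Ioc (S.a₁ : ℝ) S.b₁) ×ˢ
      (Set.Ioc (R.a₂ : ℝ) R.b₂ ∩ Set.Ioc (S.a₂ : ℝ) S.b₂) := by
    rw [OffDiagRect.toSet, OffDiagRect.toSet, Set.prod_inter_prod]
  have e2 : R.toSet ∩ Prod.swap ⁻¹' S.toSet =
      (Set.Ioc (R.a₁ : ℝ) R.b₁ ∩ Set.Ioc (S.a₂ : ℝ) S.b₂) ×ˢ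
      (Set.Ioc (R.a₂ : ℝ) R.b₂ ∩ Set.Ioc (S.a₁ : ℝ) S.b₁) := by
    rw [OffDiagRect.toSet, OffDiagRect.toSet, Set.preimage_swap_prod, Set.prod_inter_prod]
  rw [hdisj, e1, e2, quadrant_Ioc_inter_prod, quadrant_Ioc_inter_prod]
  simp

/-- The isometry on step functions: `E[I(φ) I(ψ)] = ⟨φ, ψ⟩ + ⟨φ, ψᵀ⟩`. -/
theorem integral_stepIntegral_mul (hB : IsPreBrownianReal B P) (φ ψ : OffDiagRect →₀ ℝ) :
    ∫ ω, stepIntegral B φ ω * stepIntegral B ψ ω ∂P =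
      ∫ y, stepFun φ y * stepFun ψ y ∂quadrant + ∫ y, stepFun φ y * stepFun ψ y.swap ∂quadrant := by
  have hI (φ ψ) : Integrable (fun ω ↦ stepIntegral B φ ω * stepIntegral B ψ ω) P :=
    (memLp_stepIntegral hB φ).integrable_mul (memLp_stepIntegral hB ψ)
  have hS (φ ψ) : Integrable (fun y ↦ stepFun φ y * stepFun ψ y) quadrant :=
    (memLp_stepFun φ (p := 2)).integrable_mul (memLp_stepFun ψ (p := 2))
  have hT (φ ψ) : Integrable (fun y ↦ stepFun φ y * stepFun ψ y.swap) quadrant :=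
    (memLp_stepFun φ (p := 2)).integrable_mul
      ((memLp_stepFun ψ (p := 2)).comp_measurePreserving measurePreserving_swap_quadrant)
  induction φ using Finsupp.induction_linear with
  | zero => simp
  | add f g hf hg =>
    simp only [map_add, Pi.add_apply, add_mul]
    rw [integral_add (hI _ _) (hI _ _), integral_add (hS _ _) (hS _ _),
      integral_add (hT _ _) (hT _ _), hf, hg]
    ring
  | single R c =>
  induction ψ using Finsupp.induction_linear with
  | zero => simp
  | add f g hf hg =>
    simp only [map_add, Pi.add_apply, mul_add]
    rw [integral_add (hI _ _) (hI _ _), integral_add (hS _ _) (hS _ _),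
      integral_add (hT _ _) (hT _ _), hf, hg]
    ring
  | single S d =>
    simp only [stepIntegral_single, stepFun_single, Pi.smul_apply, smul_eq_mul,
      mul_mul_mul_comm c _ d]
    rw [integral_const_mul, integral_const_mul, integral_const_mul,
      integral_stepIntegral_rect hB]
    have e1 (y : ℝ × ℝ) : R.toSet.indicator (1 : ℝ × ℝ → ℝ) y * S.toSet.indicator 1 y =
        (R.toSet ∩ S.toSet).indicator 1 y := by
      rw [Set.inter_indicator_one]; rfl
    have e2 (y : ℝ × ℝ) : R.toSet.indicator (1 : ℝ × ℝ → ℝ) y * S.toSet.indicator 1 y.swap =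
        (R.toSet ∩ Prod.swap ⁻¹' S.toSet).indicator 1 y := by
      rw [Set.inter_indicator_one]; rfl
    simp_rw [e1, e2]
    rw [integral_indicator_one (R.measurableSet_toSet.inter S.measurableSet_toSet),
      integral_indicator_one
        (R.measurableSet_toSet.inter (measurable_swap S.measurableSet_toSet)), mul_add]

/-! ### Density of the off-diagonal step functions -/

/-- Off-diagonal step functions as elements of `L²([0, ∞)²)`. -/
noncomputable def stepFunLp : (OffDiagRect →₀ ℝ) →ₗ[ℝ] Lp ℝ 2 quadrant where
  toFun φ := (memLp_stepFun φ).toLp (stepFun φ)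
  map_add' φ ψ := by rw [← MemLp.toLp_add]; congr 1; exact map_add _ _ _
  map_smul' c φ := by
    rw [RingHom.id_apply, ← MemLp.toLp_const_smul]; congr 1; exact map_smul _ _ _

/-- The double Wiener integral of step functions as a map into `L²(P)`. -/
noncomputable def stepIntegralLp (hB : IsPreBrownianReal B P) :
    (OffDiagRect →₀ ℝ) →ₗ[ℝ] Lp ℝ 2 P where
  toFun φ := (memLp_stepIntegral hB φ).toLp (stepIntegral B φ)
  map_add' φ ψ := by rw [← MemLp.toLp_add]; congr 1; exact map_add _ _ _
  map_smul' c φ := by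
    rw [RingHom.id_apply, ← MemLp.toLp_const_smul]; congr 1; exact map_smul _ _ _

/-- A function whose integral over every off-diagonal rectangle is `0` has integral `0` over every
measurable part of such a rectangle: off-diagonal rectangles form a π-system generating the Borel
sets inside each of them. -/
theorem setIntegral_inter_rect_eq_zero {g : ℝ × ℝ → ℝ}
    (hg : ∀ R : OffDiagRect, IntegrableOn g R.toSet quadrant)
    (h : ∀ R : OffDiagRect, ∫ y in R.toSet, g y ∂quadrant = 0) (R : OffDiagRect)
    {s : Set (ℝ × ℝ)} (hs : MeasurableSet s) : ∫ y in s ∩ R.toSet, g y ∂quadrant = 0 := by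
  have hgen : (inferInstance : MeasurableSpace (ℝ × ℝ)) = MeasurableSpace.generateFrom
      (Set.image2 (· ×ˢ ·) (Set.range (Set.Iic : ℝ → Set ℝ))
        (Set.range (Set.Iic : ℝ → Set ℝ))) := by
    have hb : (inferInstance : MeasurableSpace ℝ) =
        MeasurableSpace.generateFrom (Set.range (Set.Iic : ℝ → Set ℝ)) :=
      (borel_eq_generateFrom_Iic ℝ ▸ BorelSpace.measurable_eq)
    have hspan : IsCountablySpanning (Set.range (Set.Iic : ℝ → Set ℝ)) :=
      ⟨fun n : ℕ ↦ Set.Iic (n : ℝ), fun n ↦ ⟨n, rfl⟩, Set.eq_univ_of_forall fun x ↦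
        Set.mem_iUnion.2 (exists_nat_ge x)⟩
    exact (generateFrom_eq_prod hb.symm hb.symm hspan hspan).symm
  induction s, hs using MeasurableSpace.induction_on_inter hgen
    (isPiSystem_Iic.prod isPiSystem_Iic) with
  | empty => simp
  | basic s hs =>
    obtain ⟨_, ⟨x, rfl⟩, _, ⟨y, rfl⟩, rfl⟩ := hs
    -- cutting an off-diagonal rectangle by a quadrant leaves an off-diagonal rectangle
    let S : OffDiagRect :=
      { a₁ := R.a₁
        b₁ := max R.a₁ (min R.b₁ x.toNNReal)
        a₂ := R.a₂
        b₂ := max R.a₂ (min R.b₂ y.toNNReal)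
        le₁ := le_max_left _ _
        le₂ := le_max_left _ _
        disj := by
          rcases R.disj with h | h
          · exact Or.inl ((max_le R.le₁ (min_le_left _ _)).trans h)
          · exact Or.inr ((max_le R.le₂ (min_le_left _ _)).trans h) }
    have hside (a b : ℝ≥0) (hab : a ≤ b) (x : ℝ) : Set.Iic x ∩ Set.Ioc (a : ℝ) b =
        Set.Ioc (a : ℝ) (max a (min b x.toNNReal) : ℝ≥0) := by
      ext z
      simp only [Set.mem_inter_iff, Set.mem_Iic, Set.mem_Ioc, NNReal.coe_max, NNReal.coe_min,
        Real.coe_toNNReal', le_max_iff, le_min_iff]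
      have := a.2
      constructor
      · rintro ⟨h1, h2, h3⟩
        exact ⟨h2, Or.inr ⟨h3, Or.inl h1⟩⟩
      · rintro ⟨h2, h3 | ⟨h3, h4 | h4⟩⟩
        · exact absurd h3 (not_le.2 h2)
        · exact ⟨h4, h2, h3⟩
        · have : (0 : ℝ) ≤ a := a.2
          linarith
    have : (Set.Iic x ×ˢ Set.Iic y) ∩ R.toSet = S.toSet := by
      rw [OffDiagRect.toSet, Set.prod_inter_prod, hside _ _ R.le₁, hside _ _ R.le₂]
      rfl
    rw [this, h S]
  | compl s hs ih =>
    have := integral_inter_add_sdiff (μ := quadrant) (f := g) hs (hg R)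
    rw [Set.inter_comm, ih, h R, zero_add, Set.sdiff_eq, Set.inter_comm] at this
    exact this
  | iUnion f hd hm ih =>
    rw [Set.iUnion_inter, integral_iUnion (fun i ↦ (hm i).inter R.measurableSet_toSet)
      (fun i j hij ↦ (hd hij).mono Set.inter_subset_left Set.inter_subset_left)
      ((hg R).mono_set (Set.iUnion_subset fun i ↦ Set.inter_subset_right))]
    simp [ih]

theorem ae_quadrant_pos : ∀ᵐ y ∂quadrant, 0 < y.1 ∧ 0 < y.2 := by
  have h0 : ∀ᵐ x ∂volume.restrict (Set.Ici (0 : ℝ)), 0 < x := by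
    rw [← restrict_Ioi_eq_restrict_Ici]
    exact ae_restrict_mem measurableSet_Ioi
  rw [quadrant_eq_prod]
  exact (Measure.quasiMeasurePreserving_fst.ae h0).and (Measure.quasiMeasurePreserving_snd.ae h0)

/-- Almost every point of the quadrant lies in an off-diagonal rectangle with rational corners. -/
theorem ae_exists_rect : ∃ R : ℕ → OffDiagRect, ∀ᵐ y ∂quadrant, ∃ n, y ∈ (R n).toSet := by
  let Q := {q : ℚ≥0 × ℚ≥0 × ℚ≥0 × ℚ≥0 // q.1 ≤ q.2.1 ∧ q.2.2.1 ≤ q.2.2.2 ∧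
    (q.2.1 ≤ q.2.2.1 ∨ q.2.2.2 ≤ q.1)}
  let r : Q → OffDiagRect := fun q ↦
    { a₁ := q.1.1, b₁ := q.1.2.1, a₂ := q.1.2.2.1, b₂ := q.1.2.2.2
      le₁ := by exact_mod_cast q.2.1
      le₂ := by exact_mod_cast q.2.2.1
      disj := by exact_mod_cast q.2.2.2 }
  have : Nonempty Q := ⟨⟨(0, 0, 0, 0), by simp⟩⟩
  obtain ⟨e, he⟩ := exists_surjective_nat Q
  refine ⟨fun n ↦ r (e n), ?_⟩
  have hne : ∀ᵐ y ∂quadrant, y.1 ≠ y.2 := by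
    rw [quadrant_eq_prod]
    refine (Measure.ae_prod_mem_iff_ae_ae_mem (s := {y : ℝ × ℝ | y.1 ≠ y.2})
      (measurableSet_eq_fun measurable_fst measurable_snd).compl).2 ?_
    refine ae_of_all _ fun x ↦ ?_
    refine (measure_eq_zero_iff_ae_notMem.1 (Real.volume_singleton (a := x))).filter_mono
      (ae_mono Measure.restrict_le_self) |>.mono fun z hz ↦ ?_
    simpa [eq_comm] using hz
  filter_upwards [ae_quadrant_pos, hne] with y hy hyne
  have hq {s t : ℝ} (hs : 0 ≤ s) (hst : s < t) : ∃ q : ℚ≥0, s < q ∧ (q : ℝ) < t := by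
    obtain ⟨q, h1, h2⟩ := exists_rat_btwn hst
    have : 0 ≤ q := by exact_mod_cast hs.trans h1.le
    exact ⟨⟨q, this⟩, h1, h2⟩
  suffices h : ∃ q : Q, y ∈ (r q).toSet by
    obtain ⟨q, hq⟩ := h
    obtain ⟨n, rfl⟩ := he q
    exact ⟨n, hq⟩
  rcases lt_or_gt_of_ne hyne with h | h
  · obtain ⟨a, ha, ha'⟩ := hq le_rfl hy.1
    obtain ⟨b, hb, hb'⟩ := hq hy.1.le h
    obtain ⟨c, hc, hc'⟩ := hq hy.2.le (lt_add_one y.2)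
    refine ⟨⟨(a, b, b, c), ?_, ?_, ?_⟩, ⟨?_, ?_⟩, ?_, ?_⟩
    · exact_mod_cast (ha'.trans hb).le
    · exact_mod_cast (hb'.trans hc).le
    · simp
    · exact ha'
    · exact hb.le
    · exact hb'
    · exact hc.le
  · obtain ⟨a, ha, ha'⟩ := hq le_rfl hy.2
    obtain ⟨b, hb, hb'⟩ := hq hy.2.le h
    obtain ⟨c, hc, hc'⟩ := hq hy.1.le (lt_add_one y.1)
    refine ⟨⟨(b, c, a, b), ?_, ?_, ?_⟩, ⟨?_, ?_⟩, ?_, ?_⟩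
    · exact_mod_cast (hb'.trans hc).le
    · exact_mod_cast (ha'.trans hb).le
    · simp
    · exact hb'
    · exact hc.le
    · exact ha'
    · exact hb.le

/-- Off-diagonal step functions are dense in `L²([0, ∞)²)`, since a function orthogonal to all of
them vanishes almost everywhere on each off-diagonal rectangle, and countably many of these cover
almost all of the quadrant. -/
theorem denseRange_stepFunLp : DenseRange stepFunLp := by
  change Dense ((LinearMap.range stepFunLp : Submodule ℝ _) : Set (Lp ℝ 2 quadrant))
  rw [Submodule.dense_iff_topologicalClosure_eq_top,
    Submodule.topologicalClosure_eq_top_iff, Submodule.eq_bot_iff]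
  intro g hg
  have hgL : MemLp g 2 quadrant := Lp.memLp g
  have hint (R : OffDiagRect) : IntegrableOn g R.toSet quadrant := by
    have : IsFiniteMeasure (quadrant.restrict R.toSet) :=
      ⟨by simpa using R.quadrant_toSet_lt_top⟩
    exact (hgL.restrict R.toSet).integrable (by norm_num)
  have hz (R : OffDiagRect) : ∫ y in R.toSet, g y ∂quadrant = 0 := by
    have h1 := (Submodule.mem_orthogonal _ _).1 hg (stepFunLp (Finsupp.single R 1)) ⟨_, rfl⟩
    rw [L2.inner_def] at h1
    rw [← h1, ← integral_indicator R.measurableSet_toSet]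
    refine integral_congr_ae ?_
    filter_upwards [(memLp_stepFun (p := 2) (Finsupp.single R 1)).coeFn_toLp] with y hy
    rw [show stepFunLp (Finsupp.single R 1) y = stepFun (Finsupp.single R 1) y from hy,
      stepFun_single]
    by_cases h : y ∈ R.toSet <;> simp [h]
  obtain ⟨R, hR⟩ := ae_exists_rect
  have hR0 : ∀ n, ∀ᵐ y ∂quadrant, y ∈ (R n).toSet → g y = 0 := fun n ↦ by
    rw [← ae_restrict_iff' (R n).measurableSet_toSet]
    refine (hint (R n)).ae_eq_zero_of_forall_setIntegral_eq_zero fun s hs _ ↦ ?_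
    rw [Measure.restrict_restrict hs]
    exact setIntegral_inter_rect_eq_zero hint hz (R n) hs
  rw [Lp.eq_zero_iff_ae_eq_zero]
  filter_upwards [hR, ae_all_iff.2 hR0] with y ⟨n, hn⟩ hy
  exact hy n hn

/-! ### The double Wiener integral -/

/-- Integrals of products are continuous with respect to convergence in `L²`. -/
theorem tendsto_integral_mul_of_tendsto_eLpNorm {α : Type*} [MeasurableSpace α] {μ : Measure α}
    {f g : ℕ → α → ℝ} {f' g' : α → ℝ} (hf : ∀ n, MemLp (f n) 2 μ) (hg : ∀ n, MemLp (g n) 2 μ)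
    (hf' : MemLp f' 2 μ) (hg' : MemLp g' 2 μ)
    (h1 : Tendsto (fun n ↦ eLpNorm (f n - f') 2 μ) atTop (𝓝 0))
    (h2 : Tendsto (fun n ↦ eLpNorm (g n - g') 2 μ) atTop (𝓝 0)) :
    Tendsto (fun n ↦ ∫ x, f n x * g n x ∂μ) atTop (𝓝 (∫ x, f' x * g' x ∂μ)) := by
  have e {u v : α → ℝ} (hu : MemLp u 2 μ) (hv : MemLp v 2 μ) :
      ∫ x, u x * v x ∂μ = inner ℝ (hu.toLp u) (hv.toLp v) := by
    rw [L2.inner_def]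
    refine integral_congr_ae ?_
    filter_upwards [hu.coeFn_toLp, hv.coeFn_toLp] with x hx hy
    simp [hx, hy, mul_comm]
  simp_rw [fun n ↦ e (hf n) (hg n), e hf' hg']
  exact ((Lp.tendsto_Lp_iff_tendsto_eLpNorm'' f hf f' hf').2 h1).inner
    ((Lp.tendsto_Lp_iff_tendsto_eLpNorm'' g hg g' hg').2 h2)

/-- The isometry of the double Wiener integral, `E[I₂(f) I₂(g)] = ⟨f, g⟩ + ⟨f, gᵀ⟩`. -/
theorem IsDoubleWienerIntegral.integral_mul (hB : IsPreBrownianReal B P) {f g : ℝ × ℝ → ℝ}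
    {F G : Ω → ℝ} (hF : IsDoubleWienerIntegral P B f F) (hG : IsDoubleWienerIntegral P B g G) :
    ∫ ω, F ω * G ω ∂P =
      ∫ y, f y * g y ∂quadrant + ∫ y, f y * g y.swap ∂quadrant := by
  obtain ⟨hf, hF2, φ, hφ, hφF⟩ := hF
  obtain ⟨hg, hG2, ψ, hψ, hψG⟩ := hG
  have hswap : Tendsto (fun m ↦ eLpNorm (stepFun (ψ m) ∘ Prod.swap - g ∘ Prod.swap) 2 quadrant)
      atTop (𝓝 0) := by
    refine hψ.congr fun m ↦ ?_
    exact (eLpNorm_comp_measurePreserving ((memLp_stepFun (p := 2) _).sub hg).1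
      measurePreserving_swap_quadrant).symm
  have h1 := tendsto_integral_mul_of_tendsto_eLpNorm (fun m ↦ memLp_stepIntegral hB (φ m))
    (fun m ↦ memLp_stepIntegral hB (ψ m)) hF2 hG2 hφF hψG
  have h2 := tendsto_integral_mul_of_tendsto_eLpNorm (fun m ↦ memLp_stepFun (φ m))
    (fun m ↦ memLp_stepFun (ψ m)) hf hg hφ hψ
  have h3 := tendsto_integral_mul_of_tendsto_eLpNorm (fun m ↦ memLp_stepFun (φ m))
    (fun m ↦ (memLp_stepFun (ψ m)).comp_measurePreserving measurePreserving_swap_quadrant) hf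
    (hg.comp_measurePreserving measurePreserving_swap_quadrant) hφ hswap
  exact tendsto_nhds_unique h1 ((h2.add h3).congr fun m ↦ (integral_stepIntegral_mul hB _ _).symm)

theorem norm_toLp_two_sq {α : Type*} [MeasurableSpace α] {μ : Measure α} {u : α → ℝ}
    (hu : MemLp u 2 μ) : ‖hu.toLp u‖ ^ 2 = ∫ x, u x * u x ∂μ := by
  rw [← real_inner_self_eq_norm_sq, L2.inner_def]
  refine integral_congr_ae ?_
  filter_upwards [hu.coeFn_toLp] with x hx
  simp [hx, sq]

/-- The isometry on step functions and `|⟨φ, φᵀ⟩| ≤ ‖φ‖²` bound the double Wiener integral. -/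
theorem norm_stepIntegralLp_le (hB : IsPreBrownianReal B P) (φ : OffDiagRect →₀ ℝ) :
    ‖stepIntegralLp hB φ‖ ≤ √2 * ‖stepFunLp φ‖ := by
  have hS := memLp_stepFun (p := 2) φ
  have hT := hS.comp_measurePreserving measurePreserving_swap_quadrant
  refine abs_le_of_sq_le_sq' ?_ (by positivity) |>.2
  rw [mul_pow, Real.sq_sqrt (by norm_num)]
  change ‖(memLp_stepIntegral hB φ).toLp _‖ ^ 2 ≤ 2 * ‖hS.toLp _‖ ^ 2
  rw [norm_toLp_two_sq, norm_toLp_two_sq, integral_stepIntegral_mul hB]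
  have hsw : ∫ y, stepFun φ y.swap * stepFun φ y.swap ∂quadrant =
      ∫ y, stepFun φ y * stepFun φ y ∂quadrant :=
    measurePreserving_swap_quadrant.integral_comp' (f := MeasurableEquiv.prodComm)
      (fun y ↦ stepFun φ y * stepFun φ y)
  have hSS : Integrable (fun y ↦ stepFun φ y * stepFun φ y) quadrant := hS.integrable_mul hS
  have hTT : Integrable (fun y ↦ stepFun φ y.swap * stepFun φ y.swap) quadrant :=
    hT.integrable_mul hT
  have hle : ∫ y, stepFun φ y * stepFun φ y.swap ∂quadrant ≤
      ∫ y, (1 / 2 * (stepFun φ y * stepFun φ y) +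
        1 / 2 * (stepFun φ y.swap * stepFun φ y.swap)) ∂quadrant := by
    refine integral_mono (hS.integrable_mul hT)
      ((hSS.const_mul _).add (hTT.const_mul _)) fun y ↦ ?_
    have := sq_nonneg (stepFun φ y - stepFun φ y.swap)
    dsimp only
    nlinarith
  rw [integral_add (hSS.const_mul _) (hTT.const_mul _), integral_const_mul,
    integral_const_mul, hsw] at hle
  linarith

/-- Every square integrable kernel has a double Wiener integral, by density of the step functions
and completeness of `L²(P)`. -/
theorem exists_isDoubleWienerIntegral (hB : IsPreBrownianReal B P) {f : ℝ × ℝ → ℝ}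
    (hf : MemLp f 2 quadrant) : ∃ F, IsDoubleWienerIntegral P B f F := by
  obtain ⟨u, hu, hulim⟩ := mem_closure_iff_seq_limit.1 (denseRange_stepFunLp (hf.toLp f))
  choose φ hφ using hu
  obtain rfl : (fun n ↦ stepFunLp (φ n)) = u := funext hφ
  have hc : CauchySeq fun n ↦ stepIntegralLp hB (φ n) := by
    have h0 := hulim.cauchySeq
    rw [Metric.cauchySeq_iff] at h0 ⊢
    intro ε hε
    obtain ⟨N, hN⟩ := h0 (ε / √2) (by positivity)
    refine ⟨N, fun m hm n hn ↦ ?_⟩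
    have := hN m hm n hn
    rw [dist_eq_norm, ← map_sub] at this ⊢
    rw [lt_div_iff₀' (by positivity)] at this
    exact (norm_stepIntegralLp_le hB _).trans_lt this
  obtain ⟨F, hF⟩ := cauchySeq_tendsto_of_complete hc
  refine ⟨F, hf, Lp.memLp F, φ, ?_, ?_⟩
  · exact (Lp.tendsto_Lp_iff_tendsto_eLpNorm'' _ (fun n ↦ memLp_stepFun (φ n)) f hf).1 hulim
  · refine (Lp.tendsto_Lp_iff_tendsto_eLpNorm'' _ (fun n ↦ memLp_stepIntegral hB (φ n)) F
      (Lp.memLp F)).1 ?_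
    rw [Lp.toLp_coeFn]
    exact hF

theorem isDoubleWienerIntegral_doubleWienerIntegral (hB : IsPreBrownianReal B P) {f : ℝ × ℝ → ℝ}
    (hf : MemLp f 2 quadrant) :
    IsDoubleWienerIntegral P B f (doubleWienerIntegral P B f) := by
  have h := exists_isDoubleWienerIntegral hB hf
  rw [doubleWienerIntegral, dif_pos h]
  exact h.choose_spec

/-- A double Wiener integral is almost surely a measurable functional of the path of `B`. The
σ-algebra generated by `B` need not consist of measurable sets, since the `B t` are only almost
everywhere measurable; the functional avoids it. -/
theorem IsDoubleWienerIntegral.exists_measurable_path (hB : IsPreBrownianReal B P)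
    {f : ℝ × ℝ → ℝ} {F : Ω → ℝ} (hF : IsDoubleWienerIntegral P B f F) :
    ∃ g : (ℝ≥0 → ℝ) → ℝ, Measurable g ∧ F =ᵐ[P] fun ω ↦ g fun t ↦ B t ω := by
  obtain ⟨-, hF2, φ, -, hφ⟩ := hF
  obtain ⟨ns, -, hns⟩ := (tendstoInMeasure_of_tendsto_eLpNorm (by norm_num)
    (fun n ↦ (memLp_stepIntegral hB (φ n)).1) hF2.1 hφ).exists_seq_tendsto_ae
  have hpath (ψ : OffDiagRect →₀ ℝ) :
      Measurable (stepIntegral (fun t (x : ℝ≥0 → ℝ) ↦ x t) ψ) ∧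
        ∀ ω, stepIntegral B ψ ω = stepIntegral (fun t (x : ℝ≥0 → ℝ) ↦ x t) ψ (fun t ↦ B t ω) := by
    induction ψ using Finsupp.induction_linear with
    | zero => simpa using measurable_zero
    | add u v hu hv =>
      simp only [map_add, Pi.add_apply]
      exact ⟨hu.1.add hv.1, fun ω ↦ by rw [hu.2, hv.2]⟩
    | single R c =>
      simp only [stepIntegral_single]
      refine ⟨?_, fun ω ↦ by simp⟩
      have (t : ℝ≥0) : Measurable fun x : ℝ≥0 → ℝ ↦ x t := measurable_pi_apply t
      exact (((this _).sub (this _)).mul ((this _).sub (this _))).const_smul c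
  refine ⟨fun x ↦ limsup (fun i ↦ stepIntegral (fun t (x : ℝ≥0 → ℝ) ↦ x t) (φ (ns i)) x) atTop,
    Measurable.limsup fun i ↦ (hpath _).1, ?_⟩
  filter_upwards [hns] with ω hω
  simp_rw [(hpath _).2] at hω
  exact hω.limsup_eq.symm

end WienerIntegral

/-! ### The derivative of the Volterra kernel -/

theorem hasDerivAt_volterraKernel {h y u : ℝ} (hh : 1 / 2 < h) (hyu : y < u) :
    HasDerivAt (fun r ↦ volterraKernel h r y)
      (volterraConst h * y ^ (1 / 2 - h) * ((u - y) ^ (h - 3 / 2) * u ^ (h - 1 / 2))) u := by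
  refine HasDerivAt.const_mul _ ?_
  refine intervalIntegral.integral_hasDerivAt_right
    (f := fun w ↦ (w - y) ^ (h - 3 / 2) * w ^ (h - 1 / 2)) ?_ ?_ ?_
  · refine IntervalIntegrable.mul_continuousOn ?_ ?_
    · have := (intervalIntegral.intervalIntegrable_rpow' (r := h - 3 / 2) (a := y - y) (b := u - y)
        (by linarith)).comp_sub_right y
      simpa using this
    · exact continuousOn_id.rpow_const fun x _ ↦ Or.inr (by linarith)
  · exact ⟨Set.univ, univ_mem, Measurable.aestronglyMeasurable (by fun_prop)⟩
  · refine ContinuousAt.mul ?_ ?_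
    · exact (continuousAt_id.sub continuousAt_const).rpow_const
        (Or.inl (by simpa [sub_eq_zero] using hyu.ne'))
    · exact continuousAt_id.rpow_const (Or.inr (by linarith))

/-- `∂₁K^h(u, y)` for `0 < y < u`, extended by `0`, with values in `[0, ∞]`. -/
noncomputable def volterraDeriv (h u y : ℝ) : ℝ≥0∞ :=
  {p : ℝ × ℝ | 0 < p.2 ∧ p.2 < p.1}.indicator (fun p ↦ ENNReal.ofReal
    (volterraConst h * p.2 ^ (1 / 2 - h) * ((p.1 - p.2) ^ (h - 3 / 2) * p.1 ^ (h - 1 / 2)))) (u, y)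

theorem measurable_volterraDeriv (h : ℝ) :
    Measurable fun p : ℝ × ℝ ↦ volterraDeriv h p.1 p.2 := by
  refine Measurable.indicator (by fun_prop) ?_
  exact (measurableSet_lt measurable_const measurable_snd).inter
    (measurableSet_lt measurable_snd measurable_fst)

theorem volterraDeriv_of_not {h u y : ℝ} (hy : ¬ (0 < y ∧ y < u)) : volterraDeriv h u y = 0 :=
  Set.indicator_of_notMem (show (u, y) ∉ {p : ℝ × ℝ | 0 < p.2 ∧ p.2 < p.1} from hy) _

theorem volterraConst_nonneg (h : ℝ) : 0 ≤ volterraConst h := Real.sqrt_nonneg _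

theorem volterraDeriv_eq_ofReal_deriv {h u y : ℝ} (hh : 1 / 2 < h) (hy : 0 < y) (hyu : y < u) :
    volterraDeriv h u y = ENNReal.ofReal (deriv (fun r ↦ volterraKernel h r y) u) := by
  rw [(hasDerivAt_volterraKernel hh hyu).deriv]
  exact Set.indicator_of_mem (show (u, y) ∈ {p : ℝ × ℝ | 0 < p.2 ∧ p.2 < p.1} from ⟨hy, hyu⟩) _

theorem deriv_volterraKernel_nonneg {h u y : ℝ} (hh : 1 / 2 < h) (hy : 0 < y) (hyu : y < u) :
    0 ≤ deriv (fun r ↦ volterraKernel h r y) u := by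
  rw [(hasDerivAt_volterraKernel hh hyu).deriv]
  have := volterraConst_nonneg h
  have := sub_pos.2 hyu
  have := hy.trans hyu
  positivity

/-! ### A Beta integral -/

theorem lintegral_Ioo_beta {α β : ℝ} (hα : 0 < α) (hβ : 0 < β) :
    ∫⁻ x in Set.Ioo (0 : ℝ) 1, ENNReal.ofReal (x ^ (α - 1) * (1 - x) ^ (β - 1)) =
      ENNReal.ofReal (ProbabilityTheory.beta α β) := by
  have hb := beta_pos hα hβ
  have h := lintegral_betaPDF_eq_one hα hβ
  rw [lintegral_betaPDF] at h
  simp_rw [mul_assoc, ENNReal.ofReal_mul (one_div_nonneg.2 hb.le)] at h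
  rw [lintegral_const_mul _ (by fun_prop)] at h
  have h2 : ENNReal.ofReal (ProbabilityTheory.beta α β) *
      ENNReal.ofReal (1 / ProbabilityTheory.beta α β) = 1 := by
    rw [← ENNReal.ofReal_mul hb.le, mul_one_div_cancel hb.ne', ENNReal.ofReal_one]
  calc _ = ENNReal.ofReal (ProbabilityTheory.beta α β) *
        ENNReal.ofReal (1 / ProbabilityTheory.beta α β) * _ := by rw [h2, one_mul]
    _ = _ := by rw [mul_assoc, h, mul_one]

/-- The substitution `y = uv(1 - x) / (v - ux)` turns this integral into a Beta integral. -/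
theorem lintegral_rpow_mul_rpow_sub {a u v : ℝ} (ha : 0 < a) (ha' : a < 1 / 2) (hu : 0 < u)
    (huv : u < v) :
    ∫⁻ y in Set.Ioo (0 : ℝ) u,
        ENNReal.ofReal (y ^ (-2 * a) * (u - y) ^ (a - 1) * (v - y) ^ (a - 1)) =
      ENNReal.ofReal (ProbabilityTheory.beta (1 - 2 * a) a * (u * v) ^ (-a) *
        (v - u) ^ (2 * a - 1)) := by
  have hv : 0 < v := hu.trans huv
  have hw : 0 < v - u := sub_pos.2 huv
  have hden (x : ℝ) (hx : x ∈ Set.Ioo (0 : ℝ) 1) : 0 < v - u * x := by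
    have := mul_lt_of_lt_one_right hu hx.2
    linarith
  let f : ℝ → ℝ := fun x ↦ u * v * (1 - x) / (v - u * x)
  let f' : ℝ → ℝ := fun x ↦ -(u * v * (v - u)) / (v - u * x) ^ 2
  have hf (x : ℝ) (hx : x ∈ Set.Ioo (0 : ℝ) 1) :
      HasDerivWithinAt f (f' x) (Set.Ioo 0 1) x := by
    have h1 : HasDerivAt (fun x ↦ u * v * (1 - x)) (u * v * (-1)) x :=
      ((hasDerivAt_id x).const_sub 1).const_mul _
    have h2 : HasDerivAt (fun x ↦ v - u * x) (-(u * 1)) x :=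
      ((hasDerivAt_id x).const_mul u).const_sub v
    have h3 := h1.div h2 (hden x hx).ne'
    refine (h3.congr_deriv ?_).hasDerivWithinAt
    simp only [f']
    congr 1
    ring
  have hinj : Set.InjOn f (Set.Ioo 0 1) := by
    intro x hx y hy hxy
    simp only [f] at hxy
    rw [div_eq_div_iff (hden x hx).ne' (hden y hy).ne'] at hxy
    have h1 : u * v * (v - u) * (y - x) = 0 := by linear_combination hxy
    have h2 : y - x = 0 := by
      rcases mul_eq_zero.1 h1 with h | h
      · exact absurd h (by positivity)
      · exact h
    linarith
  have himg : f '' Set.Ioo 0 1 = Set.Ioo 0 u := by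
    ext y
    constructor
    · rintro ⟨x, hx, rfl⟩
      have hd := hden x hx
      have h1 : 0 < 1 - x := by linarith [hx.2]
      refine ⟨by simp only [f]; positivity, ?_⟩
      simp only [f]
      rw [div_lt_iff₀ hd]
      have : 0 < u * (x * (v - u)) := by have := hx.1; positivity
      linarith
    · intro hy
      have h1 : 0 < v - y := by linarith [hy.2]
      -- the substitution is inverted by `x = v(u - y) / (u(v - y))`
      refine ⟨v * (u - y) / (u * (v - y)), ⟨?_, ?_⟩, ?_⟩
      · have := sub_pos.2 hy.2
        positivity
      · rw [div_lt_one (by positivity)]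
        have := mul_pos hy.1 hw
        linarith
      · have e1 : v - u * (v * (u - y) / (u * (v - y))) = v * (v - u) / (v - y) := by
          field_simp; ring
        have e2 : 1 - v * (u - y) / (u * (v - y)) = y * (v - u) / (u * (v - y)) := by
          field_simp; ring
        simp only [f]
        rw [e1, e2]
        field_simp
  rw [← himg, lintegral_image_eq_lintegral_abs_deriv_mul measurableSet_Ioo hf hinj]
  have hC : 0 ≤ (u * v) ^ (-a) * (v - u) ^ (2 * a - 1) := by positivity
  rw [mul_assoc, mul_comm (ProbabilityTheory.beta _ _), ENNReal.ofReal_mul hC,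
    ProbabilityTheory.beta, add_comm (1 - 2 * a), mul_comm (Real.Gamma (1 - 2 * a)),
    ← ProbabilityTheory.beta, ← lintegral_Ioo_beta ha (by linarith),
    ← lintegral_const_mul _ (by fun_prop)]
  refine setLIntegral_congr_fun measurableSet_Ioo fun x hx ↦ ?_
  have hd := hden x hx
  have hx0 := hx.1
  have hx1 : 0 < 1 - x := by linarith [hx.2]
  rw [← ENNReal.ofReal_mul (abs_nonneg _), ← ENNReal.ofReal_mul hC]
  congr 1
  have e1 : u - f x = u * x * (v - u) / (v - u * x) := by
    simp only [f]; field_simp; ring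
  have e2 : v - f x = v * (v - u) / (v - u * x) := by
    simp only [f]; field_simp; ring
  have e3 : |f' x| = u * v * (v - u) / (v - u * x) ^ 2 := by
    simp only [f']
    rw [neg_div, abs_neg, abs_of_pos (by positivity)]
  rw [e1, e2, e3]
  simp only [f]
  -- both sides are products of powers of positive numbers, so it suffices to compare logarithms
  refine Real.log_injOn_pos (Set.mem_Ioi.2 (by positivity)) (Set.mem_Ioi.2 (by positivity)) ?_
  have L (r s : ℝ) (hr : 0 < r) : Real.log (r ^ s) = s * Real.log r := Real.log_rpow hr s
  have M (r s : ℝ) (hr : 0 < r) (hs : 0 < s) : Real.log (r * s) = Real.log r + Real.log s :=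
    Real.log_mul hr.ne' hs.ne'
  have D (r s : ℝ) (hr : 0 < r) (hs : 0 < s) : Real.log (r / s) = Real.log r - Real.log s :=
    Real.log_div hr.ne' hs.ne'
  rw [M _ _ (by positivity) (by positivity), M _ _ (by positivity) (by positivity),
    M _ _ (by positivity) (by positivity), M _ _ (by positivity) (by positivity),
    M _ _ (by positivity) (by positivity), M _ _ (by positivity) (by positivity),
    L _ _ (by positivity), L _ _ (by positivity), L _ _ (by positivity), L _ _ (by positivity),
    L _ _ (by positivity), L _ _ (by positivity), L _ _ (by positivity),
    D _ _ (by positivity) (by positivity), D _ _ (by positivity) (by positivity),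
    D _ _ (by positivity) (by positivity), D _ _ (by positivity) (by positivity),
    M _ _ (by positivity) (by positivity), M _ _ (by positivity) (by positivity),
    M _ _ (by positivity) (by positivity), M _ _ (by positivity) (by positivity),
    M _ _ (by positivity) (by positivity), M u x hu hx0, M v (v - u) hv hw, Real.log_pow]
  push_cast
  ring

/-! ### Inner products of the Rosenblatt kernels -/

/-- The reproducing identity of the Volterra kernel,
`∫ ∂₁K^h(u, y) ∂₁K^h(v, y) dy = h (2h - 1) |u - v|^{2h - 2}`. -/
theorem lintegral_volterraDeriv_mul {h u v : ℝ} (hh : 1 / 2 < h) (hh1 : h < 1) (hu : 0 < u)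
    (hv : 0 < v) (huv : u ≠ v) :
    ∫⁻ y, volterraDeriv h u y * volterraDeriv h v y =
      ENNReal.ofReal (h * (2 * h - 1) * |u - v| ^ (2 * h - 2)) := by
  wlog hlt : u < v generalizing u v
  · rw [abs_sub_comm, ← this hv hu huv.symm (lt_of_le_of_ne (not_lt.1 hlt) huv.symm)]
    simp_rw [mul_comm]
  have hbeta := lintegral_rpow_mul_rpow_sub (a := h - 1 / 2) (by linarith) (by linarith) hu hlt
  have hb : 0 < ProbabilityTheory.beta (2 - 2 * h) (h - 1 / 2) :=
    beta_pos (by linarith) (by linarith)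
  have hc : volterraConst h ^ 2 =
      h * (2 * h - 1) / ProbabilityTheory.beta (2 - 2 * h) (h - 1 / 2) :=
    Real.sq_sqrt (div_nonneg (mul_nonneg (by linarith) (by linarith)) hb.le)
  have hC : 0 ≤ volterraConst h ^ 2 * (u * v) ^ (h - 1 / 2) := by positivity
  have e : ∀ y, volterraDeriv h u y * volterraDeriv h v y =
      (Set.Ioo 0 u).indicator (fun y ↦
        ENNReal.ofReal (volterraConst h ^ 2 * (u * v) ^ (h - 1 / 2)) *
        ENNReal.ofReal (y ^ (-2 * (h - 1 / 2)) * (u - y) ^ (h - 1 / 2 - 1) *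
          (v - y) ^ (h - 1 / 2 - 1))) y := by
    intro y
    by_cases hy : y ∈ Set.Ioo 0 u
    · rw [Set.indicator_of_mem hy]
      have hyv : y < v := hy.2.trans hlt
      have h0 := hy.1
      rw [volterraDeriv_eq_ofReal_deriv hh hy.1 hy.2, volterraDeriv_eq_ofReal_deriv hh hy.1 hyv,
        ← ENNReal.ofReal_mul (deriv_volterraKernel_nonneg hh hy.1 hy.2), ← ENNReal.ofReal_mul hC,
        (hasDerivAt_volterraKernel hh hy.2).deriv, (hasDerivAt_volterraKernel hh hyv).deriv]
      congr 1
      rw [Real.mul_rpow hu.le hv.le, show -2 * (h - 1 / 2) = (1 / 2 - h) + (1 / 2 - h) by ring,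
        Real.rpow_add h0, show h - 1 / 2 - 1 = h - 3 / 2 by ring]
      ring
    · rw [Set.indicator_of_notMem hy, volterraDeriv_of_not (u := u) (by simpa using hy), zero_mul]
  simp_rw [e]
  rw [lintegral_indicator measurableSet_Ioo, lintegral_const_mul _ (by fun_prop), hbeta,
    ← ENNReal.ofReal_mul hC]
  congr 1
  have h1 : (u * v) ^ (h - 1 / 2) * (u * v) ^ (-(h - 1 / 2)) = 1 := by
    rw [← Real.rpow_add (mul_pos hu hv), add_neg_cancel, Real.rpow_zero]
  rw [abs_sub_comm, abs_of_pos (sub_pos.2 hlt), hc, show 1 - 2 * (h - 1 / 2) = 2 - 2 * h by ring,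
    show 2 * (h - 1 / 2) - 1 = 2 * h - 2 by ring]
  calc _ = h * (2 * h - 1) / ProbabilityTheory.beta (2 - 2 * h) (h - 1 / 2) *
        ProbabilityTheory.beta (2 - 2 * h) (h - 1 / 2) *
          ((u * v) ^ (h - 1 / 2) * (u * v) ^ (-(h - 1 / 2))) * (v - u) ^ (2 * h - 2) := by ring
    _ = _ := by rw [h1, div_mul_cancel₀ _ hb.ne', mul_one]

/-- The Rosenblatt kernel without its constant, with values in `[0, ∞]`. -/
noncomputable def kernelLIntegral (h t : ℝ) (y : ℝ × ℝ) : ℝ≥0∞ :=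
  ∫⁻ u in Set.Ioc 0 t, volterraDeriv h u y.1 * volterraDeriv h u y.2

theorem measurable_kernelLIntegral (h t : ℝ) : Measurable (kernelLIntegral h t) := by
  have h1 : Measurable fun p : (ℝ × ℝ) × ℝ ↦ volterraDeriv h p.2 p.1.1 :=
    (measurable_volterraDeriv h).comp (by fun_prop : Measurable fun p : (ℝ × ℝ) × ℝ ↦ (p.2, p.1.1))
  have h2 : Measurable fun p : (ℝ × ℝ) × ℝ ↦ volterraDeriv h p.2 p.1.2 :=
    (measurable_volterraDeriv h).comp (by fun_prop : Measurable fun p : (ℝ × ℝ) × ℝ ↦ (p.2, p.1.2))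
  exact (h1.mul h2).lintegral_prod_right'

/-- Tonelli's theorem turns the inner product of two kernels into a double integral of the squared
reproducing kernel. -/
theorem lintegral_kernelLIntegral_mul (h s t : ℝ) :
    ∫⁻ y, kernelLIntegral h s y * kernelLIntegral h t y =
      ∫⁻ u in Set.Ioc 0 s, ∫⁻ v in Set.Ioc 0 t,
        (∫⁻ y, volterraDeriv h u y * volterraDeriv h v y) ^ 2 := by
  have hm {α : Type} [MeasurableSpace α] {f g : α → ℝ} (hf : Measurable f) (hg : Measurable g) :
      Measurable fun x ↦ volterraDeriv h (f x) (g x) :=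
    (measurable_volterraDeriv h).comp (hf.prodMk hg)
  have e : ∀ y, kernelLIntegral h s y * kernelLIntegral h t y =
      ∫⁻ u in Set.Ioc 0 s, ∫⁻ v in Set.Ioc 0 t,
        (volterraDeriv h u y.1 * volterraDeriv h v y.1) *
          (volterraDeriv h u y.2 * volterraDeriv h v y.2) := by
    intro y
    have hy : Measurable fun u ↦ volterraDeriv h u y.1 * volterraDeriv h u y.2 :=
      (hm measurable_id measurable_const).mul (hm measurable_id measurable_const)
    rw [kernelLIntegral, ← lintegral_mul_const _ hy]
    refine lintegral_congr fun u ↦ ?_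
    rw [kernelLIntegral, ← lintegral_const_mul _ hy]
    exact lintegral_congr fun v ↦ by ring
  simp_rw [e]
  rw [lintegral_lintegral_swap]
  swap
  · refine Measurable.aemeasurable ?_
    refine Measurable.lintegral_prod_right' (f := fun p : ((ℝ × ℝ) × ℝ) × ℝ ↦
      (volterraDeriv h p.1.2 p.1.1.1 * volterraDeriv h p.2 p.1.1.1) *
          (volterraDeriv h p.1.2 p.1.1.2 * volterraDeriv h p.2 p.1.1.2)) ?_
    exact ((hm (by fun_prop) (by fun_prop)).mul (hm (by fun_prop) (by fun_prop))).mul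
      ((hm (by fun_prop) (by fun_prop)).mul (hm (by fun_prop) (by fun_prop)))
  refine lintegral_congr fun u ↦ ?_
  rw [lintegral_lintegral_swap]
  swap
  · exact (((hm (by fun_prop) (by fun_prop)).mul (hm (by fun_prop) (by fun_prop))).mul
      ((hm (by fun_prop) (by fun_prop)).mul (hm (by fun_prop) (by fun_prop)))).aemeasurable
  refine lintegral_congr fun v ↦ ?_
  have huv : AEMeasurable (fun y ↦ volterraDeriv h u y * volterraDeriv h v y) volume :=
    ((hm measurable_const measurable_id).mul (hm measurable_const measurable_id)).aemeasurable
  rw [Measure.volume_eq_prod, lintegral_prod_mul huv huv, sq]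

theorem lintegral_Ioc_abs_sub_rpow {q u t : ℝ} (hq : 0 < q) (hu : 0 ≤ u) (hut : u ≤ t) :
    ∫⁻ v in Set.Ioc 0 t, ENNReal.ofReal (|u - v| ^ (q - 1)) =
      ENNReal.ofReal ((u ^ q + (t - u) ^ q) / q) := by
  have hint (b : ℝ) : IntervalIntegrable (fun x : ℝ ↦ x ^ (q - 1)) volume 0 b :=
    intervalIntegral.intervalIntegrable_rpow' (by linarith)
  have hpow (b : ℝ) : ∫ x in (0 : ℝ)..b, x ^ (q - 1) = b ^ q / q := by
    rw [integral_rpow (Or.inl (by linarith)), sub_add_cancel, Real.zero_rpow hq.ne', sub_zero]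
  have i1 : IntervalIntegrable (fun v : ℝ ↦ (u - v) ^ (q - 1)) volume 0 u := by
    simpa using ((hint u).comp_sub_left u).symm
  have i2 : IntervalIntegrable (fun v : ℝ ↦ (v - u) ^ (q - 1)) volume u t := by
    simpa using (hint (t - u)).comp_sub_right u
  have e1 : ∫⁻ v in Set.Ioc 0 u, ENNReal.ofReal (|u - v| ^ (q - 1)) =
      ENNReal.ofReal (u ^ q / q) := by
    rw [setLIntegral_congr_fun (g := fun v ↦ ENNReal.ofReal ((u - v) ^ (q - 1))) measurableSet_Ioc
      fun v hv ↦ by simp only [abs_of_nonneg (sub_nonneg.2 hv.2)],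
      ← ofReal_integral_eq_lintegral_ofReal
        ((intervalIntegrable_iff_integrableOn_Ioc_of_le hu).1 i1)
        ((ae_restrict_iff' measurableSet_Ioc).2 (ae_of_all _ fun v hv ↦
          Real.rpow_nonneg (sub_nonneg.2 hv.2) _)), ← intervalIntegral.integral_of_le hu,
      intervalIntegral.integral_comp_sub_left (fun x ↦ x ^ (q - 1)) u]
    simp [hpow]
  have e2 : ∫⁻ v in Set.Ioc u t, ENNReal.ofReal (|u - v| ^ (q - 1)) =
      ENNReal.ofReal ((t - u) ^ q / q) := by
    rw [setLIntegral_congr_fun (g := fun v ↦ ENNReal.ofReal ((v - u) ^ (q - 1))) measurableSet_Ioc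
      fun v hv ↦ by simp only [abs_sub_comm u v, abs_of_nonneg (sub_nonneg.2 hv.1.le)],
      ← ofReal_integral_eq_lintegral_ofReal
        ((intervalIntegrable_iff_integrableOn_Ioc_of_le hut).1 i2)
        ((ae_restrict_iff' measurableSet_Ioc).2 (ae_of_all _ fun v hv ↦
          Real.rpow_nonneg (sub_nonneg.2 hv.1.le) _)), ← intervalIntegral.integral_of_le hut,
      intervalIntegral.integral_comp_sub_right (fun x ↦ x ^ (q - 1)) u]
    simp [hpow]
  rw [← Set.Ioc_union_Ioc_eq_Ioc hu hut, lintegral_union measurableSet_Ioc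
    (Set.Ioc_disjoint_Ioc_of_le le_rfl), e1, e2, ← ENNReal.ofReal_add (by positivity)
      (div_nonneg (Real.rpow_nonneg (sub_nonneg.2 hut) _) hq.le), add_div]

theorem lintegral_lintegral_abs_sub_rpow {q s t : ℝ} (hq : 0 < q) (hs : 0 ≤ s) (hst : s ≤ t) :
    ∫⁻ u in Set.Ioc 0 s, ∫⁻ v in Set.Ioc 0 t, ENNReal.ofReal (|u - v| ^ (q - 1)) =
      ENNReal.ofReal ((s ^ (q + 1) + t ^ (q + 1) - (t - s) ^ (q + 1)) / (q * (q + 1))) := by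
  have i1 : IntervalIntegrable (fun u : ℝ ↦ u ^ q) volume 0 s :=
    intervalIntegral.intervalIntegrable_rpow' (by linarith)
  have i2 : IntervalIntegrable (fun u : ℝ ↦ (t - u) ^ q) volume 0 s := by
    have := (intervalIntegral.intervalIntegrable_rpow' (r := q) (a := t) (b := t - s)
      (by linarith)).comp_sub_left t
    simpa using this
  have hi : IntervalIntegrable (fun u : ℝ ↦ (u ^ q + (t - u) ^ q) / q) volume 0 s :=
    (i1.add i2).div_const q
  rw [setLIntegral_congr_fun (g := fun u ↦ ENNReal.ofReal ((u ^ q + (t - u) ^ q) / q))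
    measurableSet_Ioc fun u hu ↦ lintegral_Ioc_abs_sub_rpow hq hu.1.le (hu.2.trans hst),
    ← ofReal_integral_eq_lintegral_ofReal ((intervalIntegrable_iff_integrableOn_Ioc_of_le hs).1 hi)
      ((ae_restrict_iff' measurableSet_Ioc).2 (ae_of_all _ fun u hu ↦ div_nonneg (add_nonneg
        (Real.rpow_nonneg hu.1.le _) (Real.rpow_nonneg (by linarith [hu.2]) _)) hq.le)),
    ← intervalIntegral.integral_of_le hs, intervalIntegral.integral_div,
    intervalIntegral.integral_add i1 i2,
    intervalIntegral.integral_comp_sub_left (fun x ↦ x ^ q) t,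
    integral_rpow (Or.inl (by linarith)), integral_rpow (Or.inl (by linarith)),
    Real.zero_rpow (by linarith), sub_zero, sub_zero]
  congr 1
  field_simp
  ring

/-- `⟨ℓ_s, ℓ_t⟩` for `ℓ_t = L_t / d(H)`. -/
theorem lintegral_kernelLIntegral_mul_eq {H s t : ℝ} (hH : H ∈ Set.Ioo (1 / 2 : ℝ) 1)
    (hs : 0 ≤ s) (hst : s ≤ t) :
    ∫⁻ y, kernelLIntegral ((H + 1) / 2) s y * kernelLIntegral ((H + 1) / 2) t y =
      ENNReal.ofReal ((H * (H + 1) / 2) ^ 2 *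
        ((s ^ (2 * H) + t ^ (2 * H) - (t - s) ^ (2 * H)) / ((2 * H - 1) * (2 * H)))) := by
  obtain ⟨hH0, hH1⟩ := hH
  rw [lintegral_kernelLIntegral_mul]
  have hC : 0 ≤ (H * (H + 1) / 2) ^ 2 := by positivity
  have key : ∀ u ∈ Set.Ioc 0 s, ∫⁻ v in Set.Ioc 0 t,
      (∫⁻ y, volterraDeriv ((H + 1) / 2) u y * volterraDeriv ((H + 1) / 2) v y) ^ 2 =
      ENNReal.ofReal ((H * (H + 1) / 2) ^ 2) *
        ∫⁻ v in Set.Ioc 0 t, ENNReal.ofReal (|u - v| ^ (2 * H - 1 - 1)) := by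
    intro u hu
    rw [← lintegral_const_mul _ (by fun_prop)]
    refine lintegral_congr_ae ?_
    have hne : ∀ᵐ v ∂volume.restrict (Set.Ioc 0 t), v ≠ u :=
      ae_restrict_of_ae (by simp [ae_iff])
    filter_upwards [ae_restrict_mem measurableSet_Ioc, hne] with v hv hvu
    rw [lintegral_volterraDeriv_mul (by linarith) (by linarith) hu.1 hv.1 hvu.symm,
      ← ENNReal.ofReal_pow (mul_nonneg (mul_nonneg (by linarith) (by linarith))
        (by positivity)), ← ENNReal.ofReal_mul hC]
    congr 1
    have : 0 < |u - v| := abs_pos.2 (sub_ne_zero.2 hvu.symm)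
    rw [mul_pow, sq (|u - v| ^ _), ← Real.rpow_add this]
    congr 2 <;> ring
  rw [setLIntegral_congr_fun measurableSet_Ioc key, lintegral_const_mul' _ _ (by simp),
    lintegral_lintegral_abs_sub_rpow (by linarith) hs hst, sub_add_cancel, ← ENNReal.ofReal_mul hC]

/-- Off the axes, the Bochner integral in `L_t(y)` is the real value of a Lebesgue integral with
nonnegative integrand. The equality includes the points of the diagonal, where the integral diverges
and both sides take the value `0`. -/
theorem rosenblattKernel_eq {H t : ℝ} (hH : H ∈ Set.Ioo (1 / 2 : ℝ) 1) (y : ℝ × ℝ)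
    (hy1 : 0 < y.1) (hy2 : 0 < y.2) : rosenblattKernel H t y =
      rosenblattConst H * (kernelLIntegral ((H + 1) / 2) t y).toReal := by
  have hh : 1 / 2 < (H + 1) / 2 := by linarith [hH.1]
  by_cases hy : y ∈ Set.Icc 0 t ×ˢ Set.Icc 0 t
  · rw [rosenblattKernel, Set.indicator_of_mem hy]
    have hm : max y.1 y.2 ≤ t := max_le hy.1.2 hy.2.2
    have hlt {u : ℝ} (hu : u ∈ Set.Ioc (max y.1 y.2) t) : y.1 < u ∧ y.2 < u :=
      ⟨(le_max_left _ _).trans_lt hu.1, (le_max_right _ _).trans_lt hu.1⟩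
    congr 1
    rw [intervalIntegral.integral_of_le hm, kernelLIntegral, integral_eq_lintegral_of_nonneg_ae]
    · congr 1
      -- the integrand of `kernelLIntegral` vanishes for `u ≤ y₁ ∨ y₂`
      rw [← Set.Ioc_union_Ioc_eq_Ioc (hy1.le.trans (le_max_left y.1 y.2)) hm,
        lintegral_union measurableSet_Ioc (Set.Ioc_disjoint_Ioc_of_le le_rfl)]
      have h0 : ∫⁻ u in Set.Ioc 0 (max y.1 y.2), volterraDeriv ((H + 1) / 2) u y.1 *
          volterraDeriv ((H + 1) / 2) u y.2 = 0 := by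
        refine setLIntegral_eq_zero measurableSet_Ioc fun u hu ↦ ?_
        rcases le_max_iff.1 hu.2 with h | h
        · simp [volterraDeriv_of_not (h := (H + 1) / 2) (fun h' ↦ not_lt.2 h h'.2)]
        · simp [volterraDeriv_of_not (h := (H + 1) / 2) (fun h' ↦ not_lt.2 h h'.2)]
      rw [h0, zero_add]
      refine setLIntegral_congr_fun measurableSet_Ioc fun u hu ↦ ?_
      obtain ⟨h1, h2⟩ := hlt hu
      rw [volterraDeriv_eq_ofReal_deriv hh hy1 h1, volterraDeriv_eq_ofReal_deriv hh hy2 h2,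
        ENNReal.ofReal_mul (deriv_volterraKernel_nonneg hh hy1 h1)]
    · refine (ae_restrict_iff' measurableSet_Ioc).2 (ae_of_all _ fun u hu ↦ ?_)
      exact mul_nonneg (deriv_volterraKernel_nonneg hh hy1 (hlt hu).1)
        (deriv_volterraKernel_nonneg hh hy2 (hlt hu).2)
    · have hmeas : Measurable fun u ↦
          (volterraDeriv ((H + 1) / 2) u y.1 * volterraDeriv ((H + 1) / 2) u y.2).toReal :=
        (((measurable_volterraDeriv _).comp (measurable_id.prodMk measurable_const)).mul
          ((measurable_volterraDeriv _).comp
            (measurable_id.prodMk measurable_const))).ennreal_toReal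
      refine hmeas.aestronglyMeasurable.congr
        ((ae_restrict_iff' measurableSet_Ioc).2 (ae_of_all _ fun u hu ↦ ?_))
      obtain ⟨h1, h2⟩ := hlt hu
      beta_reduce
      rw [volterraDeriv_eq_ofReal_deriv hh hy1 h1, volterraDeriv_eq_ofReal_deriv hh hy2 h2,
        ENNReal.toReal_mul, ENNReal.toReal_ofReal (deriv_volterraKernel_nonneg hh hy1 h1),
        ENNReal.toReal_ofReal (deriv_volterraKernel_nonneg hh hy2 h2)]
  · rw [rosenblattKernel, Set.indicator_of_notMem hy]
    have h0 : kernelLIntegral ((H + 1) / 2) t y = 0 := by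
      refine setLIntegral_eq_zero measurableSet_Ioc fun u hu ↦ ?_
      have : t < y.1 ∨ t < y.2 := by
        by_contra! h
        exact hy ⟨⟨hy1.le, h.1⟩, hy2.le, h.2⟩
      rcases this with h | h
      · simp [volterraDeriv_of_not (h := (H + 1) / 2) (u := u) (y := y.1)
          (fun h' ↦ by linarith [hu.2, h'.2])]
      · simp [volterraDeriv_of_not (h := (H + 1) / 2) (u := u) (y := y.2)
          (fun h' ↦ by linarith [hu.2, h'.2])]
    simp [h0]

theorem rosenblattKernel_swap (H t : ℝ) (y : ℝ × ℝ) :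
    rosenblattKernel H t y.swap = rosenblattKernel H t y := by
  simp only [rosenblattKernel, Set.indicator, Set.mem_prod, Prod.fst_swap, Prod.snd_swap,
    max_comm y.2 y.1, and_comm, mul_comm]

theorem kernelLIntegral_of_not {h t : ℝ} {y : ℝ × ℝ} (hy : ¬ (0 < y.1 ∧ 0 < y.2)) :
    kernelLIntegral h t y = 0 := by
  refine setLIntegral_eq_zero measurableSet_Ioc fun u hu ↦ ?_
  rw [not_and_or] at hy
  rcases hy with hy | hy
  · simp [volterraDeriv_of_not (h := h) (u := u) (y := y.1) (fun h' ↦ hy h'.1)]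
  · simp [volterraDeriv_of_not (h := h) (u := u) (y := y.2) (fun h' ↦ hy h'.1)]

theorem ae_rosenblattKernel_eq {H : ℝ} (hH : H ∈ Set.Ioo (1 / 2 : ℝ) 1) (t : ℝ) :
    rosenblattKernel H t =ᵐ[quadrant] fun y ↦
      rosenblattConst H * (kernelLIntegral ((H + 1) / 2) t y).toReal := by
  filter_upwards [ae_quadrant_pos] with y hy
  exact rosenblattKernel_eq hH y hy.1 hy.2

theorem lintegral_quadrant_kernelLIntegral_mul (h s t : ℝ) :
    ∫⁻ y, kernelLIntegral h s y * kernelLIntegral h t y ∂quadrant =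
      ∫⁻ y, kernelLIntegral h s y * kernelLIntegral h t y := by
  rw [quadrant, ← lintegral_indicator (measurableSet_Ici.prod measurableSet_Ici)]
  refine lintegral_congr fun y ↦ ?_
  by_cases hy : 0 < y.1 ∧ 0 < y.2
  · rw [Set.indicator_of_mem (show y ∈ Set.Ici (0 : ℝ) ×ˢ Set.Ici (0 : ℝ) from ⟨hy.1.le, hy.2.le⟩)]
  · simp [Set.indicator, kernelLIntegral_of_not hy]

theorem integral_rosenblattKernel_mul {H s t : ℝ} (hH : H ∈ Set.Ioo (1 / 2 : ℝ) 1)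
    (hs : 0 ≤ s) (hst : s ≤ t) :
    2 * ∫ y, rosenblattKernel H s y * rosenblattKernel H t y ∂quadrant =
      (s ^ (2 * H) + t ^ (2 * H) - (t - s) ^ (2 * H)) / 2 := by
  have hL := lintegral_kernelLIntegral_mul_eq hH hs hst
  rw [← lintegral_quadrant_kernelLIntegral_mul] at hL
  have hm : Measurable fun y ↦ kernelLIntegral ((H + 1) / 2) s y *
      kernelLIntegral ((H + 1) / 2) t y :=
    (measurable_kernelLIntegral _ s).mul (measurable_kernelLIntegral _ t)
  have e : ∫ y, rosenblattKernel H s y * rosenblattKernel H t y ∂quadrant =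
      ∫ y, rosenblattConst H ^ 2 * (kernelLIntegral ((H + 1) / 2) s y *
        kernelLIntegral ((H + 1) / 2) t y).toReal ∂quadrant := by
    refine integral_congr_ae ?_
    filter_upwards [ae_rosenblattKernel_eq hH s, ae_rosenblattKernel_eq hH t] with y h1 h2
    rw [h1, h2, ENNReal.toReal_mul]
    ring
  have hfin : ∀ᵐ y ∂quadrant, kernelLIntegral ((H + 1) / 2) s y *
      kernelLIntegral ((H + 1) / 2) t y < ∞ :=
    ae_lt_top hm (by rw [hL]; exact ENNReal.ofReal_ne_top)
  rw [e, integral_const_mul, integral_toReal hm.aemeasurable hfin, hL]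
  obtain ⟨hH0, hH1⟩ := hH
  have hnn : (t - s) ^ (2 * H) ≤ t ^ (2 * H) :=
    Real.rpow_le_rpow (sub_nonneg.2 hst) (by linarith) (by linarith)
  have hs2 : 0 ≤ s ^ (2 * H) := Real.rpow_nonneg hs _
  have h2H : 0 < 2 * H - 1 := by linarith
  have hHp : 0 < H := by linarith
  rw [ENNReal.toReal_ofReal (mul_nonneg (by positivity) (div_nonneg (by linarith) (by positivity))),
    rosenblattConst, mul_pow, Real.sq_sqrt (by positivity)]
  field_simp

theorem memLp_rosenblattKernel {H t : ℝ} (hH : H ∈ Set.Ioo (1 / 2 : ℝ) 1) (ht : 0 ≤ t) :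
    MemLp (rosenblattKernel H t) 2 quadrant := by
  rw [memLp_congr_ae (ae_rosenblattKernel_eq hH t)]
  refine MemLp.const_mul ?_ _
  have hL := lintegral_kernelLIntegral_mul_eq hH ht le_rfl
  rw [← lintegral_quadrant_kernelLIntegral_mul] at hL
  have hm := (measurable_kernelLIntegral ((H + 1) / 2) t)
  rw [memLp_two_iff_integrable_sq hm.ennreal_toReal.aestronglyMeasurable]
  refine (integrable_toReal_of_lintegral_ne_top (hm.mul hm).aemeasurable
    (hL.trans_ne ENNReal.ofReal_ne_top)).congr (ae_of_all _ fun y ↦ ?_)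
  simp only [Pi.mul_apply]
  rw [ENNReal.toReal_mul, sq]

/-! ### Decay of the covariance and the double sums -/

theorem rho_neg (H : ℝ) (k : ℤ) : rho H (-k) = rho H k := by
  have h1 : |-(k : ℝ) + 1| = |(k : ℝ) - 1| := by rw [← abs_neg]; congr 1; ring
  have h2 : |-(k : ℝ) - 1| = |(k : ℝ) + 1| := by rw [← abs_neg]; congr 1; ring
  simp only [rho, Int.cast_neg, h1, h2, abs_neg]
  ring

theorem abs_second_difference_rpow_le {H x : ℝ} (hH : H ∈ Set.Ioo (1 / 2 : ℝ) 1) (hx : 2 ≤ x) :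
    |(x + 1) ^ (2 * H) + (x - 1) ^ (2 * H) - 2 * x ^ (2 * H)| ≤ 8 * x ^ (2 * H - 2) := by
  obtain ⟨hH0, hH1⟩ := hH
  have hd (r z : ℝ) (hz : 0 < z) : HasDerivAt (fun z : ℝ ↦ z ^ r) (r * z ^ (r - 1)) z :=
    Real.hasDerivAt_rpow_const (Or.inl hz.ne')
  -- the mean value theorem, applied twice
  obtain ⟨ξ, hξ, h1⟩ := exists_hasDerivAt_eq_slope
    (fun z : ℝ ↦ (z + 1) ^ (2 * H) - z ^ (2 * H))
    (fun z ↦ 2 * H * (z + 1) ^ (2 * H - 1) - 2 * H * z ^ (2 * H - 1)) (a := x - 1) (b := x)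
    (by linarith)
    (ContinuousOn.sub
      ((continuousOn_id.add continuousOn_const).rpow_const fun z hz ↦ Or.inr (by linarith))
      (continuousOn_id.rpow_const fun z hz ↦ Or.inr (by linarith)))
    (fun z hz ↦ by
      have hz0 : 0 < z := by linarith [hz.1]
      exact ((hd (2 * H) (z + 1) (by linarith)).comp_add_const z 1).sub (hd (2 * H) z hz0))
  have hξ0 : 0 < ξ := by linarith [hξ.1]
  obtain ⟨η, hη, h2⟩ := exists_hasDerivAt_eq_slope (fun z : ℝ ↦ z ^ (2 * H - 1))
    (fun z ↦ (2 * H - 1) * z ^ (2 * H - 1 - 1)) (a := ξ) (b := ξ + 1) (by linarith)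
    (continuousOn_id.rpow_const fun z hz ↦ Or.inr (by linarith))
    (fun z hz ↦ hd _ z (hξ0.trans hz.1))
  simp only [sub_sub_cancel, div_one, sub_add_cancel, add_sub_cancel_left] at h1 h2
  have hη0 : 0 < η := hξ0.trans hη.1
  have heq : (x + 1) ^ (2 * H) + (x - 1) ^ (2 * H) - 2 * x ^ (2 * H) =
      2 * H * ((2 * H - 1) * η ^ (2 * H - 2)) := by
    rw [show 2 * H - 2 = 2 * H - 1 - 1 by ring, h2]
    linarith
  have hle : η ^ (2 * H - 2) ≤ 4 * x ^ (2 * H - 2) := by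
    calc η ^ (2 * H - 2) ≤ (x / 2) ^ (2 * H - 2) :=
          Real.rpow_le_rpow_of_nonpos (by linarith) (by linarith [hη.1, hξ.1]) (by linarith)
      _ = 2 ^ (2 - 2 * H) * x ^ (2 * H - 2) := by
          rw [Real.div_rpow (by linarith) (by norm_num), div_eq_inv_mul,
            ← Real.rpow_neg (by norm_num), neg_sub]
      _ ≤ 2 ^ (2 : ℝ) * x ^ (2 * H - 2) := by
          gcongr
          · norm_num
          · linarith
      _ = 4 * x ^ (2 * H - 2) := by norm_num
  have hηn : 0 ≤ η ^ (2 * H - 2) := by positivity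
  have hcoef : 2 * H * (2 * H - 1) ≤ 2 := by nlinarith
  have hcoef0 : 0 ≤ 2 * H * (2 * H - 1) := mul_nonneg (by linarith) (by linarith)
  rw [heq, ← mul_assoc, abs_of_nonneg (mul_nonneg hcoef0 hηn)]
  calc _ ≤ 2 * (4 * x ^ (2 * H - 2)) := mul_le_mul hcoef hle hηn (by norm_num)
    _ = _ := by ring

/-- `ρ_H(k)² = O(|k|^{4H - 4})`; the maximum with `1` covers `k = 0`. -/
theorem rho_sq_le {H : ℝ} (hH : H ∈ Set.Ioo (1 / 2 : ℝ) 1) (k : ℤ) :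
    rho H k ^ 2 ≤ 16 * (max 1 (k.natAbs : ℝ)) ^ (4 * H - 4) := by
  wlog hk : 0 ≤ k generalizing k
  · have := this (-k) (by omega)
    rwa [rho_neg, Int.natAbs_neg] at this
  obtain ⟨m, rfl⟩ := Int.eq_ofNat_of_zero_le hk
  rw [Int.natAbs_natCast]
  have h2H : 2 * H ≠ 0 := by linarith [hH.1]
  rcases Nat.lt_or_ge m 2 with hm | hm
  · interval_cases m
    · norm_num [rho, Real.zero_rpow h2H]
    · have h4 : (2 : ℝ) ^ (2 * H) ≤ 2 ^ (2 : ℝ) :=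
        Real.rpow_le_rpow_of_exponent_le (by norm_num) (by linarith [hH.2])
      have h0 : (0 : ℝ) ≤ 2 ^ (2 * H) := by positivity
      norm_num at h4
      norm_num [rho, Real.zero_rpow h2H]
      nlinarith
  · have hm' : (2 : ℝ) ≤ m := by exact_mod_cast hm
    have h := abs_second_difference_rpow_le hH hm'
    rw [max_eq_right (by linarith)]
    have he : rho H (m : ℤ) =
        1 / 2 * (((m : ℝ) + 1) ^ (2 * H) + ((m : ℝ) - 1) ^ (2 * H) - 2 * (m : ℝ) ^ (2 * H)) := by
      simp only [rho, Int.cast_natCast]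
      rw [abs_of_nonneg (by linarith), abs_of_nonneg (by linarith), abs_of_nonneg (by linarith)]
    have hab : |rho H (m : ℤ)| ≤ 4 * (m : ℝ) ^ (2 * H - 2) := by
      rw [he, abs_mul]
      norm_num
      linarith
    calc rho H m ^ 2 = |rho H m| ^ 2 := (sq_abs _).symm
      _ ≤ (4 * (m : ℝ) ^ (2 * H - 2)) ^ 2 := by gcongr
      _ = 16 * (m : ℝ) ^ (4 * H - 4) := by
        rw [mul_pow, sq ((m : ℝ) ^ _), ← Real.rpow_add (by linarith)]
        norm_num
        ring_nf

/-- A double sum over differences is controlled by `d` times a single sum, each value `|k - l| = m`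
being taken at most twice for fixed `k`. -/
theorem sum_sum_sub_le {f : ℤ → ℝ} {F : ℕ → ℝ} (hF : ∀ m, 0 ≤ F m)
    (hf : ∀ k, f k ≤ F k.natAbs) (d : ℕ) :
    ∑ k ∈ Finset.range d, ∑ l ∈ Finset.range d, f ((k : ℤ) - (l : ℤ)) ≤
      d * (2 * ∑ m ∈ Finset.range d, F m) := by
  have h (k : ℕ) (hk : k ∈ Finset.range d) :
      ∑ l ∈ Finset.range d, f ((k : ℤ) - (l : ℤ)) ≤ 2 * ∑ m ∈ Finset.range d, F m := by
    rw [Finset.mem_range] at hk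
    refine (Finset.sum_le_sum fun l _ ↦ hf _).trans ?_
    rw [← Finset.sum_filter_add_sum_filter_not _ (fun l ↦ l ≤ k), two_mul]
    have aux (s : Finset ℕ) (g : ℕ → ℕ) (hg : Set.InjOn g s) (hs : ∀ l ∈ s, g l < d)
        (he : ∀ l ∈ s, ((k : ℤ) - (l : ℤ)).natAbs = g l) :
        ∑ l ∈ s, F ((k : ℤ) - (l : ℤ)).natAbs ≤ ∑ m ∈ Finset.range d, F m := by
      rw [Finset.sum_congr rfl fun l hl ↦ by rw [he l hl], ← Finset.sum_image (f := F) hg]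
      refine Finset.sum_le_sum_of_subset_of_nonneg (fun m hm ↦ ?_) fun m _ _ ↦ hF m
      obtain ⟨l, hl, rfl⟩ := Finset.mem_image.1 hm
      exact Finset.mem_range.2 (hs l hl)
    refine add_le_add (aux _ (fun l ↦ k - l) ?_ ?_ ?_) (aux _ (fun l ↦ l - k) ?_ ?_ ?_)
    · intro a ha b hb hab
      simp only [Finset.coe_filter, Set.mem_ofPred_eq] at ha hb hab
      omega
    · intro l hl
      omega
    · intro l hl
      simp only [Finset.mem_filter] at hl
      omega
    · intro a ha b hb hab
      simp only [Finset.coe_filter, Set.mem_ofPred_eq] at ha hb hab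
      omega
    · intro l hl
      simp only [Finset.mem_filter, Finset.mem_range] at hl
      omega
    · intro l hl
      simp only [Finset.mem_filter] at hl
      omega
  simpa using Finset.sum_le_sum h

theorem sum_sum_rho_sq_le {H : ℝ} (hH : H ∈ Set.Ioo (1 / 2 : ℝ) 1) (d : ℕ) :
    ∑ k ∈ Finset.range d, ∑ l ∈ Finset.range d, rho H ((k : ℤ) - (l : ℤ)) ^ 2 ≤
      32 * d * (1 + ∑ m ∈ Finset.range d, ((m : ℝ) + 1) ^ (4 * H - 4)) := by
  refine (sum_sum_sub_le (f := fun k ↦ rho H k ^ 2)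
    (F := fun m ↦ 16 * (max 1 (m : ℝ)) ^ (4 * H - 4)) (fun m ↦ by positivity)
    (fun k ↦ rho_sq_le hH k) d).trans ?_
  have : ∑ m ∈ Finset.range d, 16 * (max 1 (m : ℝ)) ^ (4 * H - 4) ≤
      16 * (1 + ∑ m ∈ Finset.range d, ((m : ℝ) + 1) ^ (4 * H - 4)) := by
    rw [← Finset.mul_sum]
    refine mul_le_mul_of_nonneg_left ?_ (by norm_num)
    refine (Finset.sum_le_sum_of_subset_of_nonneg
      (Finset.range_subset_range.2 (Nat.le_succ d)) fun m _ _ ↦ by positivity).trans ?_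
    rw [Finset.sum_range_succ', add_comm]
    refine add_le_add (by simp) (Finset.sum_le_sum fun m _ ↦ ?_)
    push_cast
    rw [max_eq_right (by linarith [Nat.cast_nonneg (α := ℝ) m])]
  have hd : (0 : ℝ) ≤ d := Nat.cast_nonneg d
  nlinarith [mul_le_mul_of_nonneg_left this hd]

theorem sum_rpow_sub_one_le {r : ℝ} (hr : 0 < r) (hr1 : r ≤ 1) (d : ℕ) :
    ∑ m ∈ Finset.range d, ((m : ℝ) + 1) ^ (r - 1) ≤ (d : ℝ) ^ r / r := by
  rw [le_div_iff₀ hr]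
  induction d with
  | zero => simp [Real.zero_rpow hr.ne']
  | succ n ih =>
    rw [Finset.sum_range_succ, add_mul]
    have hn : (0 : ℝ) < n + 1 := by positivity
    -- Bernoulli's inequality for `n = (n + 1) (1 - 1 / (n + 1))`
    have hb := rpow_one_add_le_one_add_mul_self (s := -(1 / ((n : ℝ) + 1)))
      (by rw [neg_le_neg_iff, div_le_one hn]; linarith [Nat.cast_nonneg (α := ℝ) n]) hr.le hr1
    have h1 : (n : ℝ) ^ r = ((n : ℝ) + 1) ^ r * (1 + -(1 / ((n : ℝ) + 1))) ^ r := by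
      have h0 : (1 + -(1 / ((n : ℝ) + 1))) = n / (n + 1) := by field_simp; ring
      rw [h0, ← Real.mul_rpow hn.le (by positivity)]
      congr 1
      field_simp
    have h2 := mul_le_mul_of_nonneg_left hb (Real.rpow_nonneg hn.le r)
    rw [← h1] at h2
    have h3 : ((n : ℝ) + 1) ^ (r - 1) = ((n : ℝ) + 1) ^ r / (n + 1) :=
      Real.rpow_sub_one hn.ne' r
    have h4 : ((n : ℝ) + 1) ^ r * (1 + r * -(1 / ((n : ℝ) + 1))) =
        ((n : ℝ) + 1) ^ r - ((n : ℝ) + 1) ^ (r - 1) * r := by rw [h3]; field_simp; ring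
    push_cast
    linarith

/-- The three regimes of the double sum. -/
theorem exists_sum_sum_rho_sq_le {H : ℝ} (hH : H ∈ Set.Ioo (1 / 2 : ℝ) 1) :
    ∃ C : ℝ, 0 < C ∧
      (H < 3 / 4 → ∀ d : ℕ, 1 ≤ d → (d : ℝ) ^ (-2 * H) * ∑ k ∈ Finset.range d,
        ∑ l ∈ Finset.range d, rho H ((k : ℤ) - (l : ℤ)) ^ 2 ≤ C * (d : ℝ) ^ (1 - 2 * H)) ∧
      (H = 3 / 4 → ∀ d : ℕ, 2 ≤ d → (d : ℝ) ^ (-2 * H) * ∑ k ∈ Finset.range d,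
        ∑ l ∈ Finset.range d, rho H ((k : ℤ) - (l : ℤ)) ^ 2 ≤
          C * (Real.log d * (d : ℝ) ^ (-(1 / 2) : ℝ))) ∧
      (3 / 4 < H → ∀ d : ℕ, 1 ≤ d → (d : ℝ) ^ (-2 * H) * ∑ k ∈ Finset.range d,
        ∑ l ∈ Finset.range d, rho H ((k : ℤ) - (l : ℤ)) ^ 2 ≤ C * (d : ℝ) ^ (2 * H - 2)) := by
  have key (d : ℕ) (hd : 1 ≤ d) (b : ℝ)
      (hb : 1 + ∑ m ∈ Finset.range d, ((m : ℝ) + 1) ^ (4 * H - 4) ≤ b) :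
      (d : ℝ) ^ (-2 * H) * ∑ k ∈ Finset.range d,
        ∑ l ∈ Finset.range d, rho H ((k : ℤ) - (l : ℤ)) ^ 2 ≤ 32 * b * (d : ℝ) ^ (1 - 2 * H) := by
    have hd0 : (0 : ℝ) < d := by exact_mod_cast hd
    calc _ ≤ (d : ℝ) ^ (-2 * H) * (32 * d * b) := by
          gcongr
          exact (sum_sum_rho_sq_le hH d).trans (by gcongr)
      _ = 32 * b * (d : ℝ) ^ (1 - 2 * H) := by
          rw [show 1 - 2 * H = -2 * H + 1 by ring, Real.rpow_add hd0, Real.rpow_one]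
          ring
  rcases lt_trichotomy H (3 / 4) with h | h | h
  · have hs : Summable fun m : ℕ ↦ ((m : ℝ) + 1) ^ (4 * H - 4) := by
      have := (summable_nat_add_iff 1).2
        (Real.summable_nat_rpow (p := 4 * H - 4).2 (by linarith))
      simpa using this
    have h0 : 0 ≤ ∑' m : ℕ, ((m : ℝ) + 1) ^ (4 * H - 4) := tsum_nonneg fun m ↦ by positivity
    refine ⟨32 * (1 + ∑' m : ℕ, ((m : ℝ) + 1) ^ (4 * H - 4)), by positivity, fun _ d hd ↦ ?_,
      fun h' ↦ absurd h' h.ne, fun h' ↦ absurd h' h.not_gt⟩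
    exact key d hd _ (by gcongr; exact hs.sum_le_tsum _ fun m _ ↦ by positivity)
  · refine ⟨32 * (2 / Real.log 2 + 1), ?_, fun h' ↦ absurd h h'.ne, fun _ d hd ↦ ?_,
      fun h' ↦ absurd h h'.ne'⟩
    · have := Real.log_pos one_lt_two
      positivity
    have hl2 : 0 < Real.log 2 := Real.log_pos one_lt_two
    have hlog : Real.log 2 ≤ Real.log d :=
      Real.log_le_log (by norm_num) (by exact_mod_cast hd)
    have hsum : ∑ m ∈ Finset.range d, ((m : ℝ) + 1) ^ (4 * H - 4) ≤ 1 + Real.log d := by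
      refine le_of_eq_of_le ?_ (harmonic_le_one_add_log d)
      rw [harmonic]
      push_cast
      refine Finset.sum_congr rfl fun m _ ↦ ?_
      rw [h, show (4 * (3 / 4) - 4 : ℝ) = -1 by norm_num, Real.rpow_neg_one]
    have h2 : 2 ≤ 2 / Real.log 2 * Real.log d := by
      rw [div_mul_eq_mul_div, le_div_iff₀ hl2]
      linarith
    have := key d (by omega) ((2 / Real.log 2 + 1) * Real.log d) (by linarith)
    rw [show 1 - 2 * H = -(1 / 2) by rw [h]; norm_num] at this
    linarith
  · have hr : 0 < 4 * H - 3 := by linarith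
    refine ⟨32 * (1 + 1 / (4 * H - 3)), by positivity, fun h' ↦ absurd h' h.not_gt,
      fun h' ↦ absurd h' h.ne', fun _ d hd ↦ ?_⟩
    have hd1 : (1 : ℝ) ≤ d := by exact_mod_cast hd
    have hone : 1 ≤ (d : ℝ) ^ (4 * H - 3) := Real.one_le_rpow hd1 hr.le
    have hsum := sum_rpow_sub_one_le hr (by linarith [hH.2]) d
    rw [show 4 * H - 3 - 1 = 4 * H - 4 by ring, div_eq_mul_one_div] at hsum
    refine (key d hd ((1 + 1 / (4 * H - 3)) * (d : ℝ) ^ (4 * H - 3)) (by linarith)).trans_eq ?_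
    rw [show 2 * H - 2 = (4 * H - 3) + (1 - 2 * H) by ring,
      Real.rpow_add (by linarith : (0 : ℝ) < d)]
    ring

section Wishart

variable {Ω : Type*} [MeasurableSpace Ω] {P : Measure Ω}

/-! ### Increments of the Rosenblatt process -/

theorem isDoubleWienerIntegral_rosenblatt {B : ℝ≥0 → Ω → ℝ} (hB : IsPreBrownianReal B P)
    {H t : ℝ} (hH : H ∈ Set.Ioo (1 / 2 : ℝ) 1) (ht : 0 ≤ t) :
    IsDoubleWienerIntegral P B (rosenblattKernel H t) (rosenblatt P B H t) :=
  isDoubleWienerIntegral_doubleWienerIntegral hB (memLp_rosenblattKernel hH ht)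

/-- The Rosenblatt process has the covariance of fractional Brownian motion. -/
theorem integral_rosenblatt_mul {B : ℝ≥0 → Ω → ℝ} (hB : IsPreBrownianReal B P)
    {H s t : ℝ} (hH : H ∈ Set.Ioo (1 / 2 : ℝ) 1) (hs : 0 ≤ s) (ht : 0 ≤ t) :
    ∫ ω, rosenblatt P B H s ω * rosenblatt P B H t ω ∂P =
      (s ^ (2 * H) + t ^ (2 * H) - |s - t| ^ (2 * H)) / 2 := by
  wlog hst : s ≤ t generalizing s t
  · rw [abs_sub_comm, add_comm (s ^ _), ← this ht hs (le_of_not_ge hst)]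
    simp_rw [mul_comm]
  rw [(isDoubleWienerIntegral_rosenblatt hB hH hs).integral_mul hB
    (isDoubleWienerIntegral_rosenblatt hB hH ht)]
  simp_rw [rosenblattKernel_swap]
  rw [← two_mul, integral_rosenblattKernel_mul hH hs hst, abs_sub_comm,
    abs_of_nonneg (sub_nonneg.2 hst)]

/-- The increment of the Rosenblatt process over `[k, k + 1]`. -/
noncomputable def rosenblattIncrement (P : Measure Ω) (B : ℝ≥0 → Ω → ℝ) (H : ℝ) (k : ℕ) (ω : Ω) :
    ℝ :=
  rosenblatt P B H ((k : ℝ) + 1) ω - rosenblatt P B H (k : ℝ) ω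

variable {H : ℝ}

theorem memLp_rosenblattIncrement {B : ℝ≥0 → Ω → ℝ} (hB : IsPreBrownianReal B P)
    (hH : H ∈ Set.Ioo (1 / 2 : ℝ) 1) (k : ℕ) : MemLp (rosenblattIncrement P B H k) 2 P :=
  (isDoubleWienerIntegral_rosenblatt hB hH (by positivity)).2.1.sub
    (isDoubleWienerIntegral_rosenblatt hB hH (by positivity)).2.1

theorem integral_rosenblattIncrement_mul {B : ℝ≥0 → Ω → ℝ} (hB : IsPreBrownianReal B P)
    (hH : H ∈ Set.Ioo (1 / 2 : ℝ) 1) (k l : ℕ) :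
    ∫ ω, rosenblattIncrement P B H k ω * rosenblattIncrement P B H l ω ∂P =
      rho H ((k : ℤ) - (l : ℤ)) := by
  have hL (t : ℝ) (ht : 0 ≤ t) : MemLp (rosenblatt P B H t) 2 P :=
    (isDoubleWienerIntegral_rosenblatt hB hH ht).2.1
  have hi {s t : ℝ} (hs : 0 ≤ s) (ht : 0 ≤ t) :
      Integrable (fun ω ↦ rosenblatt P B H s ω * rosenblatt P B H t ω) P :=
    (hL s hs).integrable_mul (hL t ht)
  have hk : (0 : ℝ) ≤ k := Nat.cast_nonneg k
  have hl : (0 : ℝ) ≤ l := Nat.cast_nonneg l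
  have hk1 : (0 : ℝ) ≤ (k : ℝ) + 1 := by linarith
  have hl1 : (0 : ℝ) ≤ (l : ℝ) + 1 := by linarith
  simp only [rosenblattIncrement, sub_mul, mul_sub]
  rw [integral_sub
      (f := fun ω ↦ rosenblatt P B H ((k : ℝ) + 1) ω * rosenblatt P B H ((l : ℝ) + 1) ω -
        rosenblatt P B H k ω * rosenblatt P B H ((l : ℝ) + 1) ω)
      (g := fun ω ↦ rosenblatt P B H ((k : ℝ) + 1) ω * rosenblatt P B H l ω -
        rosenblatt P B H k ω * rosenblatt P B H l ω)
      ((hi hk1 hl1).sub (hi hk hl1)) ((hi hk1 hl).sub (hi hk hl)),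
    integral_sub (hi hk1 hl1) (hi hk hl1), integral_sub (hi hk1 hl) (hi hk hl),
    integral_rosenblatt_mul hB hH hk1 hl1, integral_rosenblatt_mul hB hH hk1 hl,
    integral_rosenblatt_mul hB hH hk hl1, integral_rosenblatt_mul hB hH hk hl, rho]
  push_cast
  rw [show (k : ℝ) + 1 - (l + 1) = k - l by ring, show (k : ℝ) + 1 - l = k - l + 1 by ring,
    show (k : ℝ) - (l + 1) = k - l - 1 by ring]
  ring

theorem exists_measurable_path_rosenblattIncrement {B : ℝ≥0 → Ω → ℝ} (hB : IsPreBrownianReal B P)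
    (hH : H ∈ Set.Ioo (1 / 2 : ℝ) 1) (k : ℕ) : ∃ g : (ℝ≥0 → ℝ) → ℝ, Measurable g ∧
      rosenblattIncrement P B H k =ᵐ[P] fun ω ↦ g fun t ↦ B t ω := by
  obtain ⟨g, hg, hge⟩ := (isDoubleWienerIntegral_rosenblatt hB hH
    (t := (k : ℝ) + 1) (by positivity)).exists_measurable_path hB
  obtain ⟨g', hg', hge'⟩ := (isDoubleWienerIntegral_rosenblatt hB hH
    (t := (k : ℝ)) (by positivity)).exists_measurable_path hB
  refine ⟨fun x ↦ g x - g' x, hg.sub hg', ?_⟩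
  filter_upwards [hge, hge'] with ω h1 h2
  rw [rosenblattIncrement, h1, h2]

variable {n : ℕ} {B : Fin n → ℝ≥0 → Ω → ℝ} {i j : Fin n}

/-- Products of increments of two independent Rosenblatt processes are integrable, and their
expectations factor. -/
theorem integrable_and_integral_increments (hB : IsBrownianVector P B)
    (hH : H ∈ Set.Ioo (1 / 2 : ℝ) 1) (hij : i ≠ j) (k l : ℕ) :
    Integrable (fun ω ↦ (rosenblattIncrement P (B i) H k ω * rosenblattIncrement P (B i) H l ω) *
      (rosenblattIncrement P (B j) H k ω * rosenblattIncrement P (B j) H l ω)) P ∧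
    ∫ ω, (rosenblattIncrement P (B i) H k ω * rosenblattIncrement P (B i) H l ω) *
      (rosenblattIncrement P (B j) H k ω * rosenblattIncrement P (B j) H l ω) ∂P =
      rho H ((k : ℤ) - (l : ℤ)) ^ 2 := by
  have hBi := (hB.isBrownian i).toIsPreBrownianReal
  have hBj := (hB.isBrownian j).toIsPreBrownianReal
  obtain ⟨a, ha, hae⟩ := exists_measurable_path_rosenblattIncrement hBi hH k
  obtain ⟨b, hb, hbe⟩ := exists_measurable_path_rosenblattIncrement hBi hH l
  obtain ⟨c, hc, hce⟩ := exists_measurable_path_rosenblattIncrement hBj hH k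
  obtain ⟨e, he, hee⟩ := exists_measurable_path_rosenblattIncrement hBj hH l
  let U : Ω → ℝ := fun ω ↦ (fun x ↦ a x * b x) fun t ↦ B i t ω
  let V : Ω → ℝ := fun ω ↦ (fun x ↦ c x * e x) fun t ↦ B j t ω
  have hUV : IndepFun U V P := (hB.indep.indepFun hij).comp (ha.mul hb) (hc.mul he)
  have hU : (fun ω ↦ rosenblattIncrement P (B i) H k ω * rosenblattIncrement P (B i) H l ω)
      =ᵐ[P] U := by
    filter_upwards [hae, hbe] with ω h1 h2
    rw [h1, h2]
  have hV : (fun ω ↦ rosenblattIncrement P (B j) H k ω * rosenblattIncrement P (B j) H l ω)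
      =ᵐ[P] V := by
    filter_upwards [hce, hee] with ω h1 h2
    rw [h1, h2]
  have hUi : Integrable U P := ((memLp_rosenblattIncrement hBi hH k).integrable_mul
    (memLp_rosenblattIncrement hBi hH l)).congr hU
  have hVi : Integrable V P := ((memLp_rosenblattIncrement hBj hH k).integrable_mul
    (memLp_rosenblattIncrement hBj hH l)).congr hV
  refine ⟨(hUV.integrable_mul hUi hVi).congr (hU.mul hV).symm, ?_⟩
  refine (integral_congr_ae (hU.mul hV)).trans ?_
  rw [hUV.integral_mul_eq_mul_integral hUi.1 hVi.1, ← integral_congr_ae hU, ← integral_congr_ae hV,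
    integral_rosenblattIncrement_mul hBi hH, integral_rosenblattIncrement_mul hBj hH, sq]

/-! ### The entries of the Wishart matrix -/

theorem renormWishart_eq (hij : i ≠ j) (d : ℕ) (ω : Ω) :
    renormWishart P B H d i j ω = (c₁ H)⁻¹ * (d : ℝ) ^ (1 - H) * (1 / (d : ℝ)) *
      ∑ k ∈ Finset.range d,
        rosenblattIncrement P (B i) H k ω * rosenblattIncrement P (B j) H k ω := by
  rw [renormWishart, wishart, Matrix.sub_apply, Matrix.one_apply_ne hij, sub_zero,
    Matrix.smul_apply, smul_eq_mul, Matrix.mul_apply, ← Fin.sum_univ_eq_sum_range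
      (fun k ↦ rosenblattIncrement P (B i) H k ω * rosenblattIncrement P (B j) H k ω), mul_assoc,
    mul_assoc, mul_assoc]
  rfl

theorem memLp_renormWishart (hB : IsBrownianVector P B)
    (hH : H ∈ Set.Ioo (1 / 2 : ℝ) 1) (hij : i ≠ j) (d : ℕ) :
    MemLp (renormWishart P B H d i j) 2 P := by
  have hBi := (hB.isBrownian i).toIsPreBrownianReal
  have hBj := (hB.isBrownian j).toIsPreBrownianReal
  have hprod (k : ℕ) : MemLp (fun ω ↦ rosenblattIncrement P (B i) H k ω *
      rosenblattIncrement P (B j) H k ω) 2 P := by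
    have hm : AEStronglyMeasurable (fun ω ↦ rosenblattIncrement P (B i) H k ω *
        rosenblattIncrement P (B j) H k ω) P :=
      (memLp_rosenblattIncrement hBi hH k).1.mul (memLp_rosenblattIncrement hBj hH k).1
    rw [memLp_two_iff_integrable_sq hm]
    exact (integrable_and_integral_increments hB hH hij k k).1.congr
      (ae_of_all _ fun ω ↦ by ring)
  have hsum := memLp_finsetSum (Finset.range d) fun k _ ↦ hprod k
  have heq : renormWishart P B H d i j = fun ω ↦ (c₁ H)⁻¹ * (d : ℝ) ^ (1 - H) * (1 / (d : ℝ)) *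
      ∑ k ∈ Finset.range d,
        rosenblattIncrement P (B i) H k ω * rosenblattIncrement P (B j) H k ω :=
    funext fun ω ↦ renormWishart_eq hij d ω
  rw [heq]
  exact hsum.const_mul _

theorem integral_renormWishart_sq (hB : IsBrownianVector P B)
    (hH : H ∈ Set.Ioo (1 / 2 : ℝ) 1) (hij : i ≠ j) {d : ℕ} (hd : 1 ≤ d) :
    ∫ ω, renormWishart P B H d i j ω ^ 2 ∂P = (c₁ H)⁻¹ ^ 2 * (d : ℝ) ^ (-2 * H) *
      ∑ k ∈ Finset.range d, ∑ l ∈ Finset.range d, rho H ((k : ℤ) - (l : ℤ)) ^ 2 := by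
  have hd0 : (0 : ℝ) < d := by exact_mod_cast hd
  have hsq (ω : Ω) : renormWishart P B H d i j ω ^ 2 =
      ((c₁ H)⁻¹ * (d : ℝ) ^ (1 - H) * (1 / (d : ℝ))) ^ 2 *
        ∑ k ∈ Finset.range d, ∑ l ∈ Finset.range d,
          (rosenblattIncrement P (B i) H k ω * rosenblattIncrement P (B i) H l ω) *
            (rosenblattIncrement P (B j) H k ω * rosenblattIncrement P (B j) H l ω) := by
    rw [renormWishart_eq hij, mul_pow, sq (∑ k ∈ Finset.range d, _), Finset.sum_mul_sum]
    congr 1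
    exact Finset.sum_congr rfl fun k _ ↦ Finset.sum_congr rfl fun l _ ↦ by ring
  simp_rw [hsq]
  rw [integral_const_mul, integral_finsetSum _ fun k _ ↦ integrable_finsetSum _ fun l _ ↦
    (integrable_and_integral_increments hB hH hij k l).1]
  congr 1
  · rw [mul_pow, mul_pow, mul_assoc]
    congr 1
    rw [← mul_pow, show (d : ℝ) ^ (1 - H) * (1 / d) = (d : ℝ) ^ (-H) by
      rw [mul_one_div, ← Real.rpow_sub_one hd0.ne']; congr 1; ring, sq, ← Real.rpow_add hd0]
    congr 1
    ring
  · refine Finset.sum_congr rfl fun k _ ↦ ?_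
    rw [integral_finsetSum _ fun l _ ↦ (integrable_and_integral_increments hB hH hij k l).1]
    exact Finset.sum_congr rfl fun l _ ↦ (integrable_and_integral_increments hB hH hij k l).2

theorem c₁_pos (hH : H ∈ Set.Ioo (1 / 2 : ℝ) 1) : 0 < c₁ H := by
  obtain ⟨h0, h1⟩ := hH
  have h2 : 0 < 2 * H - 1 := by linarith
  have h3 : 0 < H := by linarith
  unfold c₁ rosenblattConst
  positivity

/-- A nonnegative sequence obeying the rate of its regime tends to `0`. -/
theorem tendsto_zero_of_rates (hH : H ∈ Set.Ioo (1 / 2 : ℝ) 1) {f : ℕ → ℝ} {C : ℝ}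
    (hf : ∀ d, 0 ≤ f d)
    (h1 : H < 3 / 4 → ∀ d : ℕ, 1 ≤ d → f d ≤ C * (d : ℝ) ^ (1 - 2 * H))
    (h2 : H = 3 / 4 → ∀ d : ℕ, 2 ≤ d → f d ≤ C * (Real.log d * (d : ℝ) ^ (-(1 / 2) : ℝ)))
    (h3 : 3 / 4 < H → ∀ d : ℕ, 1 ≤ d → f d ≤ C * (d : ℝ) ^ (2 * H - 2)) :
    Tendsto f atTop (𝓝 0) := by
  have hpow (p : ℝ) (hp : 0 < p) : Tendsto (fun d : ℕ ↦ C * (d : ℝ) ^ (-p)) atTop (𝓝 0) := by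
    simpa using ((tendsto_rpow_neg_atTop hp).comp tendsto_natCast_atTop_atTop).const_mul C
  rcases lt_trichotomy H (3 / 4) with h | h | h
  · have := hpow (2 * H - 1) (by linarith [hH.1])
    rw [neg_sub] at this
    exact squeeze_zero' (Eventually.of_forall hf)
      (eventually_atTop.2 ⟨1, fun d hd ↦ h1 h d hd⟩) this
  · refine squeeze_zero' (Eventually.of_forall hf)
      (eventually_atTop.2 ⟨2, fun d hd ↦ h2 h d hd⟩) ?_
    have hl := ((isLittleO_log_rpow_atTop (r := 1 / 2) (by norm_num)).tendsto_div_nhds_zero.comp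
      tendsto_natCast_atTop_atTop).const_mul C
    rw [mul_zero] at hl
    refine hl.congr fun d ↦ ?_
    simp only [Function.comp_apply]
    rw [Real.rpow_neg (Nat.cast_nonneg d), div_eq_mul_inv]
  · have := hpow (2 - 2 * H) (by linarith [hH.2])
    rw [neg_sub] at this
    exact squeeze_zero' (Eventually.of_forall hf)
      (eventually_atTop.2 ⟨1, fun d hd ↦ h3 h d hd⟩) this

theorem tendsto_eLpNorm_two_of_integral_sq {f : ℕ → Ω → ℝ} (hf : ∀ d, MemLp (f d) 2 P)
    (h : Tendsto (fun d ↦ ∫ ω, f d ω ^ 2 ∂P) atTop (𝓝 0)) :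
    Tendsto (fun d ↦ eLpNorm (f d) 2 P) atTop (𝓝 0) := by
  have e (d : ℕ) : eLpNorm (f d) 2 P = ENNReal.ofReal √(∫ ω, f d ω ^ 2 ∂P) := by
    rw [(hf d).eLpNorm_eq_integral_rpow_norm (by norm_num) (by norm_num)]
    simp [Real.sqrt_eq_rpow]
  simp_rw [e]
  simpa using ENNReal.tendsto_ofReal ((Real.continuous_sqrt.tendsto 0).comp h)

end Wishart

end RosenblattWishart

theorem mainTheorem4 (H : ℝ) (hH : H ∈ Set.Ioo (1 / 2 : ℝ) 1) :
    ∃ C : ℝ, 0 < C ∧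
      ∀ {Ω : Type*} [MeasurableSpace Ω] (P : Measure Ω) [IsProbabilityMeasure P] (n : ℕ)
        (B : Fin n → ℝ≥0 → Ω → ℝ) (_ : RosenblattWishart.IsBrownianVector P B)
        (i j : Fin n) (_ : i ≠ j),
        -- the entries are square integrable and tend to `0` in `L²`
        (∀ d : ℕ, 1 ≤ d → MemLp (RosenblattWishart.renormWishart P B H d i j) 2 P) ∧
        Tendsto (fun d : ℕ ↦ eLpNorm (RosenblattWishart.renormWishart P B H d i j) 2 P)
          atTop (𝓝 0) ∧
        -- the exact second moment
        (∀ d : ℕ, 1 ≤ d →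
          ∫ ω, RosenblattWishart.renormWishart P B H d i j ω ^ 2 ∂P =
            (RosenblattWishart.c₁ H)⁻¹ ^ 2 * (d : ℝ) ^ (-2 * H) *
              ∑ k ∈ Finset.range d, ∑ l ∈ Finset.range d,
                RosenblattWishart.rho H ((k : ℤ) - (l : ℤ)) ^ 2) ∧
        -- the rates in the three regimes
        (H < 3 / 4 → ∀ d : ℕ, 1 ≤ d →
          ∫ ω, RosenblattWishart.renormWishart P B H d i j ω ^ 2 ∂P ≤
            C * (d : ℝ) ^ (1 - 2 * H)) ∧
        (H = 3 / 4 → ∀ d : ℕ, 2 ≤ d →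
          ∫ ω, RosenblattWishart.renormWishart P B H d i j ω ^ 2 ∂P ≤
            C * (Real.log d * (d : ℝ) ^ (-(1 / 2) : ℝ))) ∧
        (3 / 4 < H → ∀ d : ℕ, 1 ≤ d →
          ∫ ω, RosenblattWishart.renormWishart P B H d i j ω ^ 2 ∂P ≤
            C * (d : ℝ) ^ (2 * H - 2)) := by
  obtain ⟨C, hC, h1, h2, h3⟩ := RosenblattWishart.exists_sum_sum_rho_sq_le hH
  have hc := RosenblattWishart.c₁_pos hH
  refine ⟨(RosenblattWishart.c₁ H)⁻¹ ^ 2 * C, by positivity, ?_⟩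
  intro Ω _ P _ n B hB i j hij
  have hmem := RosenblattWishart.memLp_renormWishart hB hH hij
  have hsq (d : ℕ) (hd : 1 ≤ d) := RosenblattWishart.integral_renormWishart_sq hB hH hij hd
  have hbound (d : ℕ) (hd : 1 ≤ d) (b : ℝ)
      (hb : (d : ℝ) ^ (-2 * H) * ∑ k ∈ Finset.range d, ∑ l ∈ Finset.range d,
        RosenblattWishart.rho H ((k : ℤ) - (l : ℤ)) ^ 2 ≤ C * b) :
      ∫ ω, RosenblattWishart.renormWishart P B H d i j ω ^ 2 ∂P ≤
        (RosenblattWishart.c₁ H)⁻¹ ^ 2 * C * b := by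
    rw [hsq d hd, mul_assoc, mul_assoc]
    exact mul_le_mul_of_nonneg_left hb (by positivity)
  have r1 (h : H < 3 / 4) (d : ℕ) (hd : 1 ≤ d) := hbound d hd _ (h1 h d hd)
  have r2 (h : H = 3 / 4) (d : ℕ) (hd : 2 ≤ d) := hbound d (by omega) _ (h2 h d hd)
  have r3 (h : 3 / 4 < H) (d : ℕ) (hd : 1 ≤ d) := hbound d hd _ (h3 h d hd)
  exact ⟨fun d _ ↦ hmem d, RosenblattWishart.tendsto_eLpNorm_two_of_integral_sq hmem
    (RosenblattWishart.tendsto_zero_of_rates hH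
      (fun d ↦ integral_nonneg fun ω ↦ sq_nonneg _) r1 r2 r3), hsq, r1, r2, r3⟩
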